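/- Let $F$ be a non-archimedean local field, let $\psi : F \to \mathbb{C}^\times$ be any (fixed) nontrivial continuous additive character, and let $n \ge 1$. Let $W_n$ be the $2n$-dimensional symplectic space over $F$ with ordered basis $e_n, \dots, e_1, f_1, \dots, f_n$ and symplectic form given by $\langle e_j, f_k\rangle = \delta_{jk} = -\langle f_k, e_j\rangle$, all other products of basis vectors being zero. Using this ordered basis, identify $\mathrm{SL}(W_n)$ with $\mathrm{SL}_{2n}(F)$, and let $\mathrm{Sp}(W_n) \subset \mathrm{SL}_{2n}(F)$ be the subgroup preserving the form. Let $U \subset \mathrm{SL}_{2n}(F)$ be the group of upper-triangular unipotent matrices, and for $X \in U$ let $x_i$ $(1 \le i \le 2n-1)$ be the $(i,i+1)$ entry of $X$. Let $\pi$ be a smooth complex representation of $\mathrm{SL}_{2n}(F)$ (that is, every vector has an open stabilizer) which is distinguished by $\mathrm{Sp}(W_n)$: there is a nonzero linear form $\ell_0 : \pi \to \mathbb{C}$ with $\ell_0(\pi(h)v) = \ell_0(v)$ for all $h \in \mathrm{Sp}(W_n)$ and $v \in \pi$. Then there are $\epsilon_1, \dots, \epsilon_{n-1} \in \{0,1\}$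 such that $\pi$ carries a nonzero $\mu_n$-linear form for $U$, that is, a nonzero linear form $\ell : \pi \to \mathbb{C}$ with $\ell(\pi(X)v) = \mu_n(X)\,\ell(v)$ for all $X \in U$ and $v \in \pi$, where $$\mu_n(X) = \psi\bigl(\epsilon_1[x_1 + x_{2n-1}] + \epsilon_2[x_2 + x_{2n-2}] + \cdots + \epsilon_{n-1}[x_{n-1} + x_{n+1}]\bigr).$$ -/

import Mathlib

namespace SymplecticDistinction

open scoped Matrix

/-- The Gram matrix of the symplectic form on `W_n` in the ordered basis
`e_n, …, e_1, f_1, …, f_n`, where `⟨e_j, f_k⟩ = δ_{jk} = -⟨f_k, e_j⟩` and all other products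
vanish. The first `n` indices are the `e`'s, and `e_j` and `f_j` occupy the (zero-based) positions
`n - j` and `n + j - 1`, which add up to `2 * n - 1`. -/
def gram (n : ℕ) (F : Type*) [Field F] : Matrix (Fin (2 * n)) (Fin (2 * n)) F :=
  Matrix.of fun a b =>
    if (a : ℕ) + (b : ℕ) + 1 = 2 * n then (if (a : ℕ) < n then 1 else -1) else 0

/-- The symplectic group `Sp(W_n)` inside `SL_{2n}(F) = SL(W_n)`: the matrices that preserve
the symplectic form. -/
def Sp (n : ℕ) (F : Type*) [Field F] : Subgroup (Matrix.SpecialLinearGroup (Fin (2 * n)) F) where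
  carrier := {g | (g : Matrix (Fin (2 * n)) (Fin (2 * n)) F)ᵀ * gram n F *
    (g : Matrix (Fin (2 * n)) (Fin (2 * n)) F) = gram n F}
  one_mem' := by simp
  mul_mem' := by
    intro g h hg hh
    simp only [Set.mem_ofPred_eq, Matrix.SpecialLinearGroup.coe_mul, Matrix.transpose_mul] at hg hh ⊢
    calc _ = (h : Matrix (Fin (2 * n)) (Fin (2 * n)) F)ᵀ *
          ((g : Matrix (Fin (2 * n)) (Fin (2 * n)) F)ᵀ * gram n F *
            (g : Matrix (Fin (2 * n)) (Fin (2 * n)) F)) *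
          (h : Matrix (Fin (2 * n)) (Fin (2 * n)) F) := by simp only [Matrix.mul_assoc]
      _ = gram n F := by rw [hg, hh]
  inv_mem' := by
    intro g hg
    simp only [Set.mem_ofPred_eq] at hg ⊢
    have h1 : (g : Matrix (Fin (2 * n)) (Fin (2 * n)) F) *
        ((g⁻¹ : Matrix.SpecialLinearGroup (Fin (2 * n)) F) : Matrix _ _ F) = 1 := by
      rw [← Matrix.SpecialLinearGroup.coe_mul, mul_inv_cancel, Matrix.SpecialLinearGroup.coe_one]
    have h2 : ((g⁻¹ : Matrix.SpecialLinearGroup (Fin (2 * n)) F) : Matrix _ _ F)ᵀ *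
        (g : Matrix (Fin (2 * n)) (Fin (2 * n)) F)ᵀ = 1 := by
      rw [← Matrix.transpose_mul, h1, Matrix.transpose_one]
    conv_lhs => rw [← hg]
    calc _ = (((g⁻¹ : Matrix.SpecialLinearGroup (Fin (2 * n)) F) : Matrix _ _ F)ᵀ *
          (g : Matrix (Fin (2 * n)) (Fin (2 * n)) F)ᵀ) * gram n F *
          ((g : Matrix (Fin (2 * n)) (Fin (2 * n)) F) *
          ((g⁻¹ : Matrix.SpecialLinearGroup (Fin (2 * n)) F) : Matrix _ _ F)) := by
          simp only [Matrix.mul_assoc]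
      _ = gram n F := by rw [h1, h2, Matrix.one_mul, Matrix.mul_one]

/-- The group of upper-triangular unipotent matrices in `SL_m(F)`. -/
def upperUnipotent (m : ℕ) (F : Type*) [Field F] :
    Subgroup (Matrix.SpecialLinearGroup (Fin m) F) where
  carrier := {g | (∀ i j, j < i → g i j = 0) ∧ ∀ i, g i i = 1}
  one_mem' := by
    refine ⟨fun i j hij => ?_, fun i => ?_⟩
    · simp [Matrix.one_apply_ne hij.ne']
    · simp
  mul_mem' := by
    rintro g h ⟨hg, hg1⟩ ⟨hh, hh1⟩
    refine ⟨fun i j hij => ?_, fun i => ?_⟩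
    · rw [Matrix.SpecialLinearGroup.coe_mul, Matrix.mul_apply]
      refine Finset.sum_eq_zero fun k _ => ?_
      rcases lt_or_ge k i with hk | hk
      · rw [hg i k hk, zero_mul]
      · rw [hh k j (hij.trans_le hk), mul_zero]
    · rw [Matrix.SpecialLinearGroup.coe_mul, Matrix.mul_apply, Finset.sum_eq_single i, hg1, hh1, one_mul]
      · intro k _ hk
        rcases lt_or_gt_of_ne hk with hk | hk
        · rw [hg i k hk, zero_mul]
        · rw [hh k i hk, mul_zero]
      · simp
  inv_mem' := by
    rintro g ⟨hg, hg1⟩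
    have hginv : (g : Matrix (Fin m) (Fin m) F) *
        ((g⁻¹ : Matrix.SpecialLinearGroup (Fin m) F) : Matrix (Fin m) (Fin m) F) = 1 := by
      rw [← Matrix.SpecialLinearGroup.coe_mul, mul_inv_cancel, Matrix.SpecialLinearGroup.coe_one]
    let _ : Invertible (g : Matrix (Fin m) (Fin m) F) :=
      ⟨_, mul_eq_one_comm.mp hginv, hginv⟩
    have hT : ((g⁻¹ : Matrix.SpecialLinearGroup (Fin m) F) : Matrix (Fin m) (Fin m) F).BlockTriangular
        id := by
      rw [← Matrix.inv_eq_right_inv hginv]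
      exact Matrix.blockTriangular_inv_of_blockTriangular (fun i j hij => hg i j hij)
    refine ⟨fun i j hij => hT hij, fun i => ?_⟩
    have h := congrFun (congrFun hginv i) i
    rw [Matrix.mul_apply, Finset.sum_eq_single i, hg1, one_mul, Matrix.one_apply_eq] at h
    · exact h
    · intro k _ hk
      rcases lt_or_gt_of_ne hk with hk | hk
      · rw [hg i k hk, zero_mul]
      · rw [hT (show id i < id k from hk), mul_zero]
    · simp

/-- With `x_i` denoting the (one-based) `(i, i + 1)` entry of `X`, the value
`ψ (ε_1 (x_1 + x_{2n-1}) + ε_2 (x_2 + x_{2n-2}) + ⋯ + ε_{n-1} (x_{n-1} + x_{n+1}))`.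
The summation index `k` is `i - 1`. -/
def mu {n : ℕ} {F : Type*} [Field F] (ψ : AddChar F ℂ) (ε : Fin (n - 1) → F)
    (X : Matrix.SpecialLinearGroup (Fin (2 * n)) F) : ℂ :=
  ψ (∑ k : Fin (n - 1), ε k *
    (X ⟨k, by omega⟩ ⟨k + 1, by omega⟩ +
      X ⟨2 * n - 2 - k, by omega⟩ ⟨2 * n - 1 - k, by omega⟩))

/-- A complex representation of a topological group is smooth if every vector has an open
stabilizer. -/
def IsSmoothRep {G V : Type*} [Group G] [TopologicalSpace G] [AddCommGroup V] [Module ℂ V]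
    (π : Representation ℂ G V) : Prop :=
  ∀ v : V, IsOpen {g : G | π g v = v}

/-- A representation of `G` is distinguished by a subgroup `H` if it carries a nonzero
`H`-invariant linear form. -/
def IsDistinguishedBy {G V : Type*} [Group G] [AddCommGroup V] [Module ℂ V]
    (π : Representation ℂ G V) (H : Subgroup G) : Prop :=
  ∃ l : V →ₗ[ℂ] ℂ, l ≠ 0 ∧ ∀ h ∈ H, ∀ v : V, l (π h v) = l v

end SymplecticDistinction

/-! Induction on k, removing one hyperbolic pair from the middle block at a time; `IsAdapted` is the
induction hypothesis and `IsAdapted.exists_succ` the step. At stage k, attach to each vector v the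
function y ↦ l(π(`rowElt K y`) v) of the free entries of a row. Row elements act on these functions
by translations and transvections act by shears, so they form a space E as in `IsShearStable`.

The analytic heart is `IsShearStable.exists_functional`. Members of E need not be integrable, but
small shears fix them and preserve boxes, so their Fourier coefficients over boxes are invariant
under small transvections of the frequency. Such transvections move a nonzero frequency w onto a
whole neighbourhood of w. The coefficients are therefore locally constant near w, uniformly in the
box, and averaging over that neighbourhood confines the integral to a fixed compact set: the
coefficients stabilize as the box grows. If the stable coefficient at e is a nonzero functional on
E, it gives the next form, with ε = 1. If it vanishes, transitivity of transvections on nonzero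
vectors kills every nonzero frequency, the functions are constant, and l itself is the next form,
with ε = 0.

The other properties are inherited, since row elements normalize both the outer unipotents and the
Heisenberg group, and the transvections fixing e preserve the new form. A unipotent of the next
stage factors as outer times row times Heisenberg. The Heisenberg part cancels in the sum of the two
new superdiagonal entries, which is why the character involves only x_i + x_{2n-i}. -/

namespace SymplecticDistinction

open scoped Matrix Pointwise
open ValuativeRel MeasureTheory Filter Topology

/-! ### Boxes, their annihilators under ψ, and orthogonality of characters. -/

section LocalAnalysis

variable {F : Type*} [Field F] [ValuativeRel F] {ι : Type*} {ψ : AddChar F ℂ}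

/-- The vectors all of whose coordinates are bounded by `c`. -/
def box (ι : Type*) (c : F) : AddSubgroup (ι → F) where
  carrier := {y | ∀ i, valuation F (y i) ≤ valuation F c}
  zero_mem' := by simp
  add_mem' := fun ha hb i => (valuation F).map_add_le (ha i) (hb i)
  neg_mem' := fun ha i => by simpa using ha i

theorem mem_box {c : F} {y : ι → F} :
    y ∈ box ι c ↔ ∀ i, valuation F (y i) ≤ valuation F c := Iff.rfl

theorem box_mono {c d : F} (h : valuation F c ≤ valuation F d) : box ι c ≤ box ι d :=
  fun _ hy i => (hy i).trans h

/-- The filter of scalars whose valuation tends to infinity. -/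
noncomputable def atLarge (F : Type*) [Field F] [ValuativeRel F] : Filter F :=
  comap (valuation F) atTop

theorem eventually_atLarge (c : F) : ∀ᶠ d in atLarge F, valuation F c ≤ valuation F d :=
  tendsto_comap.eventually (eventually_ge_atTop (valuation F c))

instance : (atLarge F).NeBot := by
  refine comap_neBot fun t ht => ?_
  obtain ⟨a, ha⟩ := mem_atTop_sets.1 ht
  obtain ⟨c, rfl⟩ := valuation_surjective a
  exact ⟨c, ha _ le_rfl⟩

theorem eventually_ne_zero_atLarge : ∀ᶠ d in atLarge F, d ≠ 0 := by
  filter_upwards [eventually_atLarge (1 : F)] with d hd h0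
  simp [h0] at hd

theorem exists_min_valuation {a b : F} (ha : a ≠ 0) (hb : b ≠ 0) :
    ∃ c : F, c ≠ 0 ∧ valuation F c ≤ valuation F a ∧ valuation F c ≤ valuation F b := by
  rcases le_total (valuation F a) (valuation F b) with h | h
  exacts [⟨a, ha, le_rfl, h⟩, ⟨b, hb, h, le_rfl⟩]

theorem eventually_mem_box [Finite ι] (y : ι → F) : ∀ᶠ c in atLarge F, y ∈ box ι c := by
  simp only [mem_box]
  exact Filter.eventually_all.2 fun i => eventually_atLarge (y i)

theorem exists_ne_one_of_ne_one {F : Type*} [Field F] {ψ : AddChar F ℂ} (hψ1 : ψ ≠ 1) : ∃ t : F, t ≠ 0 ∧ ψ t ≠ 1 := by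
  obtain ⟨t, ht⟩ := AddChar.ne_one_iff.1 hψ1
  exact ⟨t, fun h => ht (by rw [h, AddChar.map_zero_eq_one]), ht⟩

theorem single_mem_box [DecidableEq ι] {δ u : F} (i : ι)
    (hu : valuation F u ≤ valuation F δ) : Pi.single i u ∈ box ι δ := by
  intro j
  by_cases h : j = i
  · subst h; simpa using hu
  · simp [h]

theorem valuation_dotProduct_le [Fintype ι] {x y : ι → F} {g h : F} (hx : x ∈ box ι g) (hy : y ∈ box ι h) :
    valuation F (x ⬝ᵥ y) ≤ valuation F (g * h) := by
  refine (valuation F).map_sum_le fun i _ => ?_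
  rw [map_mul, map_mul]
  exact mul_le_mul' (hx i) (hy i)

/-- The annihilator of `box ι δ` with respect to the pairing defined by `ψ`. -/
def boxPerp (ι : Type*) [Fintype ι] (ψ : AddChar F ℂ) (δ : F) : AddSubgroup (ι → F) where
  carrier := {y | ∀ x ∈ box ι δ, ψ (x ⬝ᵥ y) = 1}
  zero_mem' := by simp
  add_mem' := fun ha hb x hx => by rw [dotProduct_add, AddChar.map_add_eq_mul, ha x hx, hb x hx, one_mul]
  neg_mem' := fun {y} ha x hx => by
    have := ha (-x) (neg_mem hx)
    rwa [neg_dotProduct, ← dotProduct_neg] at this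

/-- If y_i were too large, the vector with single coordinate t / y_i would lie in the box and pair
with y to t, where ψ is not 1. -/
theorem boxPerp_subset_box [Fintype ι] {t δ : F} (hδ : δ ≠ 0) (ht : ψ t ≠ 1) :
    boxPerp ι ψ δ ≤ box ι (t / δ) := by
  classical
  intro y hy i
  by_contra! hlt
  have hy0 : y i ≠ 0 := by
    rintro h
    simp [h] at hlt
  refine ht ?_
  have := hy (Pi.single i (t / y i)) (single_mem_box i ?_)
  · rwa [single_dotProduct, div_mul_cancel₀ _ hy0] at this
  · rw [map_div₀] at hlt ⊢
    have h1 : valuation F (y i) ≠ 0 := by simpa using hy0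
    have h2 : valuation F δ ≠ 0 := by simpa using hδ
    rw [div_le_iff₀ (zero_lt_iff.2 h1), mul_comm]
    exact ((div_lt_iff₀ (zero_lt_iff.2 h2)).1 hlt).le

variable [TopologicalSpace F] [IsNonarchimedeanLocalField F]

theorem isOpen_ball {c : F} (hc : c ≠ 0) : IsOpen {x : F | valuation F x ≤ valuation F c} := by
  let H : AddSubgroup F :=
    { carrier := {x | valuation F x ≤ valuation F c}
      zero_mem' := by simp
      add_mem' := fun {a b} ha hb => by
        rw [Set.mem_ofPred_eq] at ha hb ⊢
        exact (valuation F).map_add_le ha hb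
      neg_mem' := fun {a} ha => by simpa using ha }
  refine H.isOpen_of_mem_nhds (g := 0) ?_
  refine (IsValuativeTopology.hasBasis_nhds_zero' F).mem_iff.2
    ⟨valuation F c, by simpa using hc, fun x hx => ?_⟩
  exact (show valuation F x ≤ valuation F c from (show valuation F x < valuation F c from hx).le)

theorem exists_ball_subset {U : Set F} (hU : U ∈ 𝓝 (0 : F)) :
    ∃ c : F, c ≠ 0 ∧ ∀ x, valuation F x ≤ valuation F c → x ∈ U := by
  obtain ⟨γ, hγ, h⟩ := (IsValuativeTopology.hasBasis_nhds_zero' F).mem_iff.1 hU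
  obtain ⟨a, rfl⟩ := valuation_surjective γ
  have ha : a ≠ 0 := by simpa using hγ
  obtain ⟨r, hr0, hr⟩ := Valuation.IsNontrivial.exists_lt_one (v := valuation F)
  have hr0' : r ≠ 0 := by simpa using hr0
  refine ⟨a * r, mul_ne_zero ha hr0', fun x hx => h ?_⟩
  refine lt_of_le_of_lt hx ?_
  rw [map_mul]
  exact mul_lt_of_lt_one_right (zero_lt_iff.2 hγ) hr

theorem isCompact_box (c : F) : IsCompact (box ι c : Set (ι → F)) := by
  have : (box ι c : Set (ι → F)) = Set.pi Set.univ fun _ => {x | valuation F x ≤ valuation F c} := by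
    ext; simp [mem_box]
  rw [this]
  exact isCompact_univ_pi fun _ => IsNonarchimedeanLocalField.isCompact_closedBall F _

variable [Fintype ι]

theorem isOpen_box {c : F} (hc : c ≠ 0) : IsOpen (box ι c : Set (ι → F)) := by
  have : (box ι c : Set (ι → F)) = Set.pi Set.univ fun _ => {x | valuation F x ≤ valuation F c} := by
    ext; simp [mem_box]
  rw [this]
  exact isOpen_set_pi Set.finite_univ fun _ _ => isOpen_ball hc

theorem isClosed_box {c : F} (hc : c ≠ 0) : IsClosed (box ι c : Set (ι → F)) :=
  AddSubgroup.isClosed_of_isOpen _ (isOpen_box hc)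

theorem exists_box_subset {U : Set (ι → F)} (hU : U ∈ 𝓝 (0 : ι → F)) :
    ∃ c : F, c ≠ 0 ∧ (box ι c : Set (ι → F)) ⊆ U := by
  rw [nhds_pi, Filter.mem_pi] at hU
  obtain ⟨I, -, t, ht, h⟩ := hU
  have key : ∀ s : Finset ι, ∃ c : F, c ≠ 0 ∧
      ∀ i ∈ s, ∀ x, valuation F x ≤ valuation F c → x ∈ t i := by
    classical
    intro s
    induction s using Finset.induction_on with
    | empty => exact ⟨1, one_ne_zero, by simp⟩
    | insert i s _ ih =>
      obtain ⟨c, hc, h1⟩ := ih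
      obtain ⟨d, hd, h2⟩ := exists_ball_subset (ht i)
      obtain ⟨e, he, h3, h4⟩ := exists_min_valuation hc hd
      refine ⟨e, he, fun j hj x hx => ?_⟩
      rcases Finset.mem_insert.1 hj with rfl | hj
      · exact h2 x (hx.trans h4)
      · exact h1 j hj x (hx.trans h3)
  obtain ⟨c, hc, h'⟩ := key Finset.univ
  exact ⟨c, hc, fun y hy => h fun i _ => h' i (Finset.mem_univ i) _ (hy i)⟩

theorem eventually_subset_box {K : Set (ι → F)} (hK : IsCompact K) :
    ∀ᶠ c in atLarge F, K ⊆ box ι c := by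
  refine hK.induction_on (p := fun K => ∀ᶠ c in atLarge F, K ⊆ (box ι c : Set (ι → F)))
    (by simp) (fun s t hst ht => ht.mono fun c hc => hst.trans hc)
    (fun s t hs ht => (hs.and ht).mono fun c hc => Set.union_subset hc.1 hc.2) fun x _ => ?_
  refine ⟨x +ᵥ (box ι (1 : F) : Set (ι → F)), mem_nhdsWithin_of_mem_nhds ?_, ?_⟩
  · exact ((isOpen_box one_ne_zero).vadd x).mem_nhds ⟨0, (box ι (1 : F)).zero_mem, by simp⟩
  · filter_upwards [eventually_mem_box x, eventually_atLarge (1 : F)] with c h1 h2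
    rintro _ ⟨z, hz, rfl⟩
    exact (box ι c).add_mem h1 (box_mono h2 hz)

/-- No small subgroups: a ball is a subgroup, so all powers of a value z of ψ stay within 1/2 of 1,
while each squaring multiplies the distance to 1 by |z + 1| ≥ 3/2. -/
theorem exists_trivial_ball (hψ : Continuous ψ) :
    ∃ η : F, η ≠ 0 ∧ ∀ x, valuation F x ≤ valuation F η → ψ x = 1 := by
  have hU : {x : F | ‖ψ x - 1‖ < 1 / 2} ∈ 𝓝 (0 : F) := by
    refine IsOpen.mem_nhds ?_ (by simp)
    exact isOpen_lt (by fun_prop) continuous_const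
  obtain ⟨c, hc, h⟩ := exists_ball_subset hU
  refine ⟨c, hc, fun x hx => ?_⟩
  by_contra hne
  have hpos : 0 < ‖ψ x - 1‖ := norm_pos_iff.2 (sub_ne_zero.2 hne)
  have hclose : ∀ k : ℕ, ‖ψ x ^ k - 1‖ < 1 / 2 := fun k => by
    rw [← AddChar.map_nsmul_eq_pow]
    refine h _ ?_
    induction k with
    | zero => simp
    | succ k ih => rw [succ_nsmul]; exact (valuation F).map_add_le ih hx
  have hgrow : ∀ k : ℕ, (3 / 2 : ℝ) ^ k * ‖ψ x - 1‖ ≤ ‖ψ x ^ 2 ^ k - 1‖ := by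
    intro k
    induction k with
    | zero => simp
    | succ k ih =>
      set z := ψ x ^ 2 ^ k with hz
      have h1 : ψ x ^ 2 ^ (k + 1) - 1 = (z + 1) * (z - 1) := by
        rw [pow_succ, pow_mul, ← hz]; ring
      have h2 : 3 / 2 ≤ ‖z + 1‖ := by
        have h3 : ‖(2 : ℂ)‖ ≤ ‖z + 1‖ + ‖z - 1‖ := by
          refine le_trans (le_of_eq ?_) (norm_sub_le (z + 1) (z - 1))
          congr 1; ring
        have h4 := hclose (2 ^ k)
        rw [← hz] at h4
        simp only [Complex.norm_ofNat] at h3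
        linarith
      rw [h1, norm_mul, pow_succ, mul_comm _ (3 / 2 : ℝ), mul_assoc]
      exact mul_le_mul h2 ih (by positivity) (norm_nonneg _)
  obtain ⟨k, hk⟩ := pow_unbounded_of_one_lt (1 / 2 / ‖ψ x - 1‖) (show (1 : ℝ) < 3 / 2 by norm_num)
  rw [div_lt_iff₀ hpos] at hk
  exact absurd (hk.trans_le ((hgrow k).trans (hclose _).le)) (lt_irrefl _)

theorem isOpen_boxPerp (hψ : Continuous ψ) {δ : F} (hδ : δ ≠ 0) :
    IsOpen (boxPerp ι ψ δ : Set (ι → F)) := by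
  obtain ⟨η, hη, h⟩ := exists_trivial_ball hψ
  refine AddSubgroup.isOpen_of_mem_nhds _ (g := 0) ?_
  refine mem_of_superset ((isOpen_box (c := η / δ) (div_ne_zero hη hδ)).mem_nhds
    (zero_mem (box ι (η / δ)))) fun y hy x hx => h _ ?_
  have := valuation_dotProduct_le hx hy
  rwa [mul_div_cancel₀ _ hδ] at this

theorem isCompact_boxPerp (hψ : Continuous ψ) (hψ1 : ψ ≠ 1) {δ : F} (hδ : δ ≠ 0) :
    IsCompact (boxPerp ι ψ δ : Set (ι → F)) := by
  obtain ⟨t, -, ht⟩ := exists_ne_one_of_ne_one hψ1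
  exact (isCompact_box (t / δ)).of_isClosed_subset
    (AddSubgroup.isClosed_of_isOpen _ (isOpen_boxPerp hψ hδ)) (boxPerp_subset_box hδ ht)

variable [MeasurableSpace (ι → F)] [BorelSpace (ι → F)] (m : Measure (ι → F))

theorem integral_box_addChar_of_mem {δ : F} {y : ι → F} (hδ : δ ≠ 0) (hy : y ∈ boxPerp ι ψ δ) :
    ∫ x in (box ι δ : Set (ι → F)), ψ (-(x ⬝ᵥ y)) ∂m = m.real (box ι δ : Set (ι → F)) := by
  have hm := (isOpen_box (ι := ι) hδ).measurableSet
  rw [setIntegral_congr_fun (g := fun _ => (1 : ℂ)) hm]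
  · simp
  · intro x hx
    have := hy (-x) (neg_mem hx)
    simpa [neg_dotProduct] using this

variable [m.IsAddHaarMeasure]

/-- Translating the variable by some x₀ with ψ(x₀ · y) ≠ 1 multiplies the integral by ψ(x₀ · y). -/
theorem integral_box_addChar_eq_zero {δ : F} (hδ : δ ≠ 0) {y : ι → F} (hy : y ∉ boxPerp ι ψ δ) :
    ∫ x in (box ι δ : Set (ι → F)), ψ (-(x ⬝ᵥ y)) ∂m = 0 := by
  obtain ⟨x₀, hx₀, hne⟩ : ∃ x₀ ∈ box ι δ, ψ (x₀ ⬝ᵥ y) ≠ 1 := by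
    by_contra! h; exact hy h
  have hm := (isOpen_box (ι := ι) hδ).measurableSet
  have key : ∫ x in (box ι δ : Set (ι → F)), ψ (-(x ⬝ᵥ y)) ∂m =
      ψ (x₀ ⬝ᵥ y) * ∫ x in (box ι δ : Set (ι → F)), ψ (-(x ⬝ᵥ y)) ∂m := by
    conv_lhs => rw [← integral_indicator hm, ← integral_sub_right_eq_self _ x₀]
    rw [← integral_const_mul, ← integral_indicator hm]
    refine integral_congr_ae (Eventually.of_forall fun x => ?_)
    have : x - x₀ ∈ (box ι δ : Set (ι → F)) ↔ x ∈ (box ι δ : Set (ι → F)) :=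
      
      ⟨fun h => by simpa using (box ι δ).add_mem h hx₀, fun h => (box ι δ).sub_mem h hx₀⟩
    by_cases hx : x ∈ (box ι δ : Set (ι → F))
    · simp only [Set.indicator_of_mem (this.2 hx), Set.indicator_of_mem hx]
      rw [← AddChar.map_add_eq_mul, sub_dotProduct]
      congr 1; ring
    · simp only [Set.indicator_of_notMem (fun h => hx (this.1 h)), Set.indicator_of_notMem hx]
  have h2 : (1 - ψ (x₀ ⬝ᵥ y)) * ∫ x in (box ι δ : Set (ι → F)), ψ (-(x ⬝ᵥ y)) ∂m = 0 := by
    rw [sub_mul, one_mul, ← key, sub_self]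
  exact (mul_eq_zero.1 h2).resolve_left (sub_ne_zero.2 hne.symm)

/-- Average the hypothesis over x in the box and swap the integrals: the inner one is the volume of
the box times the indicator of `boxPerp`. -/
theorem integral_eq_integral_inter_boxPerp (hψ : Continuous ψ) {δ : F} (hδ : δ ≠ 0)
    {Λ : Set (ι → F)} (hΛ : IsCompact Λ) (hΛo : IsClopen Λ) {g : (ι → F) → ℂ} (hg : Continuous g)
    {A : ℂ} (hA : ∀ x ∈ box ι δ, ∫ y in Λ, ψ (-(x ⬝ᵥ y)) * g y ∂m = A) :
    A = ∫ y in Λ ∩ boxPerp ι ψ δ, g y ∂m := by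
  classical
  set B : Set (ι → F) := (box ι δ : Set (ι → F))
  have hBo : IsClopen B := ⟨isClosed_box hδ, isOpen_box hδ⟩
  have hBc : IsCompact B := isCompact_box δ
  have hBm := hBo.isOpen.measurableSet
  have hΛm := hΛo.isOpen.measurableSet
  have hPm : MeasurableSet (boxPerp ι ψ δ : Set (ι → F)) := (isOpen_boxPerp hψ hδ).measurableSet
  have hpos : m.real B ≠ 0 := by
    rw [measureReal_def, ENNReal.toReal_ne_zero]
    exact ⟨(hBo.isOpen.measure_pos m ⟨0, zero_mem (box ι δ)⟩).ne', hBc.measure_lt_top.ne⟩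
  -- Cutting off by a compact clopen set keeps the integrand continuous with compact support, as the
  -- swap requires.
  let f : (ι → F) → (ι → F) → ℂ := fun x y =>
    (B ×ˢ Λ).indicator (fun p => ψ (-(p.1 ⬝ᵥ p.2)) * g p.2) (x, y)
  have hfc : Continuous f.uncurry := by
    refine Continuous.indicator ?_ ?_
    · intro p hp
      rw [(hBo.prod hΛo).frontier_eq] at hp
      exact hp.elim
    · exact (hψ.comp (by fun_prop)).mul (hg.comp continuous_snd)
  have hfs : HasCompactSupport f.uncurry :=
    HasCompactSupport.intro (hBc.prod hΛ) fun p hp =>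
      (Set.indicator_of_notMem hp (fun p => ψ (-(p.1 ⬝ᵥ p.2)) * g p.2) :)
  have swap := integral_integral_swap_of_hasCompactSupport hfc hfs (μ := m) (ν := m)
  have h1 : ∀ x, ∫ y, f x y ∂m = B.indicator (fun _ => A) x := by
    intro x
    by_cases hx : x ∈ B
    · rw [Set.indicator_of_mem hx, ← hA x hx, ← integral_indicator hΛm]
      refine integral_congr_ae (Eventually.of_forall fun y => ?_)
      by_cases hy : y ∈ Λ <;> simp [f, hx, hy]
    · simp [f, hx]
  have h2 : ∀ y, ∫ x, f x y ∂m =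
      (Λ ∩ boxPerp ι ψ δ).indicator (fun y => m.real B * g y) y := by
    intro y
    by_cases hy : y ∈ Λ
    · have : ∀ x, f x y = B.indicator (fun x => ψ (-(x ⬝ᵥ y))) x * g y := by
        intro x
        by_cases hx : x ∈ B <;> simp [f, hx, hy]
      simp_rw [this]
      rw [integral_mul_const, integral_indicator hBm]
      by_cases hp : y ∈ boxPerp ι ψ δ
      · rw [Set.indicator_of_mem (show y ∈ Λ ∩ (boxPerp ι ψ δ : Set (ι → F)) from ⟨hy, hp⟩), integral_box_addChar_of_mem m hδ hp]
      · rw [Set.indicator_of_notMem (fun h : y ∈ Λ ∩ (boxPerp ι ψ δ : Set (ι → F)) => hp h.2), integral_box_addChar_eq_zero m hδ hp, zero_mul]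
    · simp [f, hy]
  simp_rw [h1, h2] at swap
  rw [integral_indicator hBm, integral_indicator (hΛm.inter hPm), integral_const_mul] at swap
  simp only [integral_const, measureReal_restrict_apply_univ, Complex.real_smul] at swap
  exact mul_left_cancel₀ (by exact_mod_cast hpos) swap

end LocalAnalysis

/-! ### Symplectic transvections and their transposes. -/

section Shear

variable {R : Type*} [CommRing R] {ι : Type*} [Fintype ι] (J : Matrix ι ι R)

/-- The symplectic transvection `x ↦ x + t ⟨a, x⟩ a` for the form with Gram matrix `J`. -/
def transv (a : ι → R) (t : R) (x : ι → R) : ι → R :=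
  x + (t * ((a ᵥ* J) ⬝ᵥ x)) • a

/-- The transpose of `transv J a t`. -/
def shear (a : ι → R) (t : R) (y : ι → R) : ι → R :=
  y + (t * (y ⬝ᵥ a)) • (a ᵥ* J)

variable {J}

theorem transv_add (a : ι → R) (t : R) (x y : ι → R) :
    transv J a t (x + y) = transv J a t x + transv J a t y := by
  simp only [transv, dotProduct_add, mul_add, add_smul]; abel

theorem shear_add (a : ι → R) (t : R) (x y : ι → R) :
    shear J a t (x + y) = shear J a t x + shear J a t y := by
  simp only [shear, add_dotProduct, mul_add, add_smul]; abel

theorem transv_dotProduct (a : ι → R) (t : R) (x y : ι → R) :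
    transv J a t x ⬝ᵥ y = x ⬝ᵥ shear J a t y := by
  simp only [transv, shear, add_dotProduct, dotProduct_add, smul_dotProduct, dotProduct_smul,
    smul_eq_mul, dotProduct_comm a y, dotProduct_comm x (a ᵥ* J)]
  ring

/-- `J` is the Gram matrix of a nondegenerate alternating form. -/
structure IsSymplecticGram (J : Matrix ι ι R) : Prop where
  alternating : ∀ a, (a ᵥ* J) ⬝ᵥ a = 0
  nondegenerate : ∀ w ≠ 0, ∃ f, (f ᵥ* J) ⬝ᵥ w ≠ 0

theorem IsSymplecticGram.skew (hJ : IsSymplecticGram J) (a b : ι → R) :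
    (a ᵥ* J) ⬝ᵥ b = -((b ᵥ* J) ⬝ᵥ a) := by
  have := hJ.alternating (a + b)
  rw [Matrix.add_vecMul, add_dotProduct, dotProduct_add, dotProduct_add, hJ.alternating,
    hJ.alternating, zero_add, add_zero] at this
  exact eq_neg_of_add_eq_zero_left this

theorem IsSymplecticGram.shear_neg_shear (hJ : IsSymplecticGram J) (a : ι → R) (t : R)
    (y : ι → R) : shear J a (-t) (shear J a t y) = y := by
  simp only [shear, add_dotProduct, smul_dotProduct, hJ.alternating, smul_eq_mul, mul_zero,
    add_zero, neg_mul, neg_smul, add_neg_cancel_right]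

theorem IsSymplecticGram.transv_neg_transv (hJ : IsSymplecticGram J) (a : ι → R) (t : R)
    (x : ι → R) : transv J a (-t) (transv J a t x) = x := by
  simp only [transv, dotProduct_add, dotProduct_smul, hJ.alternating, smul_eq_mul, mul_zero,
    add_zero, neg_mul, neg_smul, add_neg_cancel_right]

theorem IsSymplecticGram.transv_ne_zero (hJ : IsSymplecticGram J) (a : ι → R) (t : R)
    {x : ι → R} (hx : x ≠ 0) : transv J a t x ≠ 0 := fun h => hx <| by
  rw [← hJ.transv_neg_transv a t x, h]
  simp [transv]

theorem transv_sub_eq {K : Type*} [Field K] {J : Matrix ι ι K} (hJ : IsSymplecticGram J)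
    {x z : ι → K} (h : (z ᵥ* J) ⬝ᵥ x ≠ 0) :
    transv J (z - x) ((z ᵥ* J) ⬝ᵥ x)⁻¹ x = z := by
  have : ((z - x) ᵥ* J) ⬝ᵥ x = (z ᵥ* J) ⬝ᵥ x := by
    rw [Matrix.sub_vecMul, sub_dotProduct, hJ.alternating, sub_zero]
  rw [transv, this, inv_mul_cancel₀ h, one_smul, add_sub_cancel]

/-- Two transvections suffice to move a nonzero vector to any other one. -/
theorem exists_transv_transv_eq {K : Type*} [Field K] {J : Matrix ι ι K}
    (hJ : IsSymplecticGram J) {e w : ι → K} (he : e ≠ 0) (hw : w ≠ 0) :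
    ∃ a₁ t₁ a₂ t₂, transv J a₂ t₂ (transv J a₁ t₁ e) = w := by
  -- A vector space is not the union of two hyperplanes, so some z is orthogonal to neither e nor w;
  -- pass through it.
  obtain ⟨z, hz1, hz2⟩ : ∃ z, (z ᵥ* J) ⬝ᵥ e ≠ 0 ∧ (z ᵥ* J) ⬝ᵥ w ≠ 0 := by
    obtain ⟨f, hf⟩ := hJ.nondegenerate e he
    obtain ⟨g, hg⟩ := hJ.nondegenerate w hw
    by_cases hf' : (f ᵥ* J) ⬝ᵥ w = 0
    · by_cases hg' : (g ᵥ* J) ⬝ᵥ e = 0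
      · refine ⟨f + g, ?_, ?_⟩ <;> simp [Matrix.add_vecMul, add_dotProduct, *]
      · exact ⟨g, hg', hg⟩
    · exact ⟨f, hf, hf'⟩
  refine ⟨z - e, ((z ᵥ* J) ⬝ᵥ e)⁻¹, w - z, ((w ᵥ* J) ⬝ᵥ z)⁻¹, ?_⟩
  rw [transv_sub_eq hJ hz1]
  refine transv_sub_eq hJ ?_
  rwa [hJ.skew, neg_ne_zero]

end Shear

/-! ### Change of variables by shears. -/

section ShearMeasure

variable {F : Type*} [Field F] [ValuativeRel F] [TopologicalSpace F] [IsNonarchimedeanLocalField F]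
  {ι : Type*} [Fintype ι] {J : Matrix ι ι F}

@[fun_prop]
theorem continuous_shear (a : ι → F) (t : F) : Continuous (shear J a t) := by
  have : Continuous fun y : ι → F => y ⬝ᵥ a := Continuous.dotProduct continuous_id continuous_const
  unfold shear
  fun_prop

@[fun_prop]
theorem continuous_transv (a : ι → F) (t : F) : Continuous (transv J a t) := by
  have : Continuous fun y : ι → F => (a ᵥ* J) ⬝ᵥ y :=
    Continuous.dotProduct continuous_const continuous_id
  unfold transv
  fun_prop

/-- A shear as a homeomorphic automorphism of the additive group. -/
def shearEquiv (hJ : IsSymplecticGram J) (a : ι → F) (t : F) : (ι → F) ≃ₜ+ (ι → F) where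
  toFun := shear J a t
  invFun := shear J a (-t)
  left_inv := hJ.shear_neg_shear a t
  right_inv y := by simpa using hJ.shear_neg_shear a (-t) y
  map_add' := shear_add a t
  continuous_toFun := continuous_shear a t
  continuous_invFun := continuous_shear a (-t)

variable [MeasurableSpace (ι → F)] [BorelSpace (ι → F)] (m : Measure (ι → F))
  [m.IsAddHaarMeasure] [m.Regular]

/-- A shear scales Haar measure by a constant, and an invariant set of finite positive measure
forces the constant to be 1. The set X is invariant because the displacement q is unchanged by the
shear. -/
theorem measurePreserving_shear (hJ : IsSymplecticGram J) (a : ι → F) (t : F) :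
    MeasurePreserving (shear J a t) m m := by
  let φ := shearEquiv hJ a t
  let B : Set (ι → F) := (box ι (1 : F) : Set (ι → F))
  let q : (ι → F) → (ι → F) := fun y => (t * (y ⬝ᵥ a)) • (a ᵥ* J)
  have hq : Continuous q := by
    have : Continuous fun y : ι → F => y ⬝ᵥ a := Continuous.dotProduct continuous_id continuous_const
    fun_prop
  have hqq : ∀ y, q (shear J a t y) = q y := fun y => by
    simp only [q, shear, add_dotProduct, smul_dotProduct, hJ.alternating, smul_eq_mul, mul_zero,
      add_zero]
  let X : Set (ι → F) := B ∩ q ⁻¹' B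
  have hX : φ ⁻¹' X = X := by
    ext y
    change (shear J a t y ∈ box ι (1 : F) ∧ q (shear J a t y) ∈ box ι (1 : F)) ↔
      (y ∈ box ι (1 : F) ∧ q y ∈ box ι (1 : F))
    rw [hqq]
    refine and_congr_left fun h => ?_
    exact AddSubgroup.add_mem_cancel_right _ h
  have hXo : IsOpen X := (isOpen_box one_ne_zero).inter ((isOpen_box one_ne_zero).preimage hq)
  have hX0 : m X ≠ 0 := by
    refine (hXo.measure_pos m ⟨0, zero_mem (box ι (1 : F)), ?_⟩).ne'
    change q 0 ∈ box ι (1 : F)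
    simp [q, zero_mem]
  have hXt : m X ≠ ⊤ :=
    ((measure_mono Set.inter_subset_left).trans_lt (isCompact_box 1).measure_lt_top).ne
  have h1 := addEquivAddHaarChar_smul_preimage m (X := X) φ
  rw [hX] at h1
  have h2 : addEquivAddHaarChar φ = 1 := by
    have h3 : (addEquivAddHaarChar φ : ENNReal) * m X = 1 * m X := by
      rw [one_mul]; exact h1
    exact_mod_cast (ENNReal.mul_left_inj hX0 hXt).1 h3
  refine ⟨(continuous_shear a t).measurable, ?_⟩
  have h4 := addEquivAddHaarChar_smul_map m φ
  rwa [h2, one_smul] at h4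

/-- The Fourier coefficient at `w` of the restriction of `Φ` to `Λ`. -/
noncomputable def fint (ψ : AddChar F ℂ) (Λ : Set (ι → F)) (Φ : (ι → F) → ℂ) (w : ι → F) : ℂ :=
  ∫ y in Λ, ψ (-(w ⬝ᵥ y)) * Φ y ∂m

theorem fint_shear (hJ : IsSymplecticGram J) (ψ : AddChar F ℂ) (Λ : Set (ι → F))
    (Φ : (ι → F) → ℂ) (a : ι → F) (t : F) (w : ι → F) :
    fint m ψ (shear J a t ⁻¹' Λ) (Φ ∘ shear J a t) (transv J a t w) = fint m ψ Λ Φ w := by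
  have := (measurePreserving_shear m hJ a t).setIntegral_preimage_emb
    (shearEquiv hJ a t).toHomeomorph.measurableEmbedding (fun y => ψ (-(w ⬝ᵥ y)) * Φ y) Λ
  simp only [fint, transv_dotProduct]
  exact this

end ShearMeasure

/-! ### Local constancy of Fourier coefficients at nonzero frequencies. -/

section StableIntegral

variable {F : Type*} [Field F] [ValuativeRel F] {ι : Type*} [Fintype ι] {J : Matrix ι ι F}

/-- A space of functions on `F ^ ι`, stable under translations and shears, all of whose members
are fixed by small translations and small shears. -/
structure IsShearStable (J : Matrix ι ι F) (E : Submodule ℂ ((ι → F) → ℂ)) : Prop where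
  translate : ∀ Φ ∈ E, ∀ y₀, (fun y => Φ (y + y₀)) ∈ E
  shear : ∀ Φ ∈ E, ∀ a t, Φ ∘ shear J a t ∈ E
  smooth : ∀ Φ ∈ E, ∃ κ : F, κ ≠ 0 ∧ (∀ y, ∀ u ∈ box ι κ, Φ (y + u) = Φ y) ∧
    ∀ a t, (∀ i j, valuation F (t * a i * a j) ≤ valuation F κ) → Φ ∘ SymplecticDistinction.shear J a t = Φ

variable {E : Submodule ℂ ((ι → F) → ℂ)}

/-- A bound for the entries of a matrix. -/
theorem exists_valuation_entry_le (M : Matrix ι ι F) :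
    ∃ C : F, C ≠ 0 ∧ ∀ i j, valuation F (M i j) ≤ valuation F C := by
  have h : ∀ᶠ c in atLarge F, ∀ i j, valuation F (M i j) ≤ valuation F c :=
    Filter.eventually_all.2 fun i => Filter.eventually_all.2 fun j => eventually_atLarge (M i j)
  obtain ⟨C, h0, hC⟩ := (eventually_ne_zero_atLarge.and h).exists
  exact ⟨C, h0, hC⟩

theorem shear_preimage_box (hJ : IsSymplecticGram J) {a : ι → F} {t c : F}
    (h : ∀ y ∈ box ι c, (t * (y ⬝ᵥ a)) • (a ᵥ* J) ∈ box ι c) :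
    shear J a t ⁻¹' (box ι c : Set (ι → F)) = box ι c := by
  ext y
  refine ⟨fun hy => ?_, fun hy => (box ι c).add_mem hy (h y hy)⟩
  have hy' : shear J a t y ∈ box ι c := hy
  have h1 := h _ hy'
  have h2 : (t * (shear J a t y ⬝ᵥ a)) • (a ᵥ* J) = (t * (y ⬝ᵥ a)) • (a ᵥ* J) := by
    simp only [shear, add_dotProduct, smul_dotProduct, hJ.alternating, smul_eq_mul, mul_zero,
      add_zero]
  rw [h2] at h1
  exact (AddSubgroup.add_mem_cancel_right _ h1).1 hy'

variable [TopologicalSpace F] [IsNonarchimedeanLocalField F]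

theorem continuous_of_periodic {Φ : (ι → F) → ℂ} {κ : F} (hκ : κ ≠ 0)
    (h : ∀ y, ∀ u ∈ box ι κ, Φ (y + u) = Φ y) : Continuous Φ := by
  refine (IsLocallyConstant.iff_exists_open Φ).2 (fun x => ?_) |>.continuous
  refine ⟨x +ᵥ (box ι κ : Set (ι → F)), (isOpen_box hκ).vadd x, ⟨0, zero_mem (box ι κ), by simp⟩, ?_⟩
  rintro _ ⟨u, hu, rfl⟩
  exact h x u hu

theorem IsShearStable.continuous (hE : IsShearStable J E) {Φ : (ι → F) → ℂ} (hΦ : Φ ∈ E) :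
    Continuous Φ := by
  obtain ⟨κ, hκ, h, -⟩ := hE.smooth Φ hΦ
  exact continuous_of_periodic hκ h

theorem fint_add_right {F ι : Type*} [Field F] [Fintype ι] [MeasurableSpace (ι → F)]
    (m : Measure (ι → F)) {ψ : AddChar F ℂ} (Λ : Set (ι → F)) (Φ : (ι → F) → ℂ) (w x : ι → F) :
    fint m ψ Λ Φ (w + x) = ∫ y in Λ, ψ (-(x ⬝ᵥ y)) * (ψ (-(w ⬝ᵥ y)) * Φ y) ∂m := by
  refine integral_congr_ae (Eventually.of_forall fun y => ?_)
  simp only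
  rw [← mul_assoc, ← AddChar.map_add_eq_mul, add_dotProduct]
  congr 2; ring

variable [MeasurableSpace (ι → F)] [BorelSpace (ι → F)] (m : Measure (ι → F))
  [m.IsAddHaarMeasure] {ψ : AddChar F ℂ}

theorem integrableOn_addChar_mul (hψ : Continuous ψ) {Φ : (ι → F) → ℂ} (hΦ : Continuous Φ)
    {Λ : Set (ι → F)} (hΛ : IsCompact Λ) (hΛm : MeasurableSet Λ) (w : ι → F) :
    IntegrableOn (fun y => ψ (-(w ⬝ᵥ y)) * Φ y) Λ m := by
  refine ContinuousOn.integrableOn_compact' hΛ hΛm (Continuous.continuousOn ?_)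
  have : Continuous fun y : ι → F => w ⬝ᵥ y := Continuous.dotProduct continuous_const continuous_id
  fun_prop

/-- Averaging over frequencies near w leaves only `boxPerp ι ψ δ`; once Λ contains it, the right
side no longer depends on Λ. -/
theorem fint_eq_of_forall_add (hψ : Continuous ψ) {Φ : (ι → F) → ℂ} (hΦ : Continuous Φ)
    {δ : F} (hδ : δ ≠ 0) {Λ : Set (ι → F)} (hΛ : IsCompact Λ) (hΛo : IsClopen Λ) {w : ι → F}
    {A : ℂ} (h : ∀ x ∈ box ι δ, fint m ψ Λ Φ (w + x) = A) :
    A = ∫ y in Λ ∩ boxPerp ι ψ δ, ψ (-(w ⬝ᵥ y)) * Φ y ∂m := by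
  refine integral_eq_integral_inter_boxPerp m hψ hδ hΛ hΛo ?_ fun x hx => ?_
  · have : Continuous fun y : ι → F => w ⬝ᵥ y := Continuous.dotProduct continuous_const continuous_id
    fun_prop
  · rw [← h x hx, fint_add_right]

variable [m.Regular]

/-- The Fourier coefficients over boxes are unchanged by a shear that preserves the function. -/
theorem fint_transv_of_small (hJ : IsSymplecticGram J) {Φ : (ι → F) → ℂ} {a : ι → F} {t : F} {C : F}
    (hC : ∀ i j, valuation F (J i j) ≤ valuation F C)
    (hsmall : ∀ i j, valuation F (t * a i * a j) * valuation F C ≤ 1)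
    (hΦ : Φ ∘ shear J a t = Φ) (w : ι → F) (c : F) :
    fint m ψ (box ι c : Set (ι → F)) Φ (transv J a t w) = fint m ψ (box ι c : Set (ι → F)) Φ w := by
  have h : shear J a t ⁻¹' (box ι c : Set (ι → F)) = box ι c := by
    refine shear_preimage_box hJ fun y hy i => ?_
    have : ((t * (y ⬝ᵥ a)) • (a ᵥ* J)) i = ∑ j, ∑ k, (t * a j * a k) * J k i * y j := by
      simp only [Pi.smul_apply, smul_eq_mul, dotProduct, Matrix.vecMul, Finset.mul_sum,
        Finset.sum_mul]
      rw [Finset.sum_comm]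
      refine Finset.sum_congr rfl fun j _ => Finset.sum_congr rfl fun k _ => ?_
      ring
    rw [this]
    refine (valuation F).map_sum_le fun j _ => (valuation F).map_sum_le fun k _ => ?_
    rw [map_mul, map_mul]
    calc _ ≤ valuation F (t * a j * a k) * valuation F C * valuation F c := by
          gcongr
          exacts [hC k i, hy j]
      _ ≤ 1 * valuation F c := by gcongr; exact hsmall j k
      _ = _ := one_mul _
  have := fint_shear m hJ ψ (box ι c : Set (ι → F)) Φ a t w
  rwa [h, hΦ] at this

/-- Go from w to w + x through z = w + s f by two transvections small enough to fix Φ and preserve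
every box. That δ does not depend on c is the point. -/
theorem exists_fint_add_eq (hJ : IsSymplecticGram J) (hE : IsShearStable J E) {Φ : (ι → F) → ℂ}
    (hΦ : Φ ∈ E) {w : ι → F} (hw : w ≠ 0) :
    ∃ δ : F, δ ≠ 0 ∧ ∀ x ∈ box ι δ, ∀ c : F,
      fint m ψ (box ι c : Set (ι → F)) Φ (w + x) = fint m ψ (box ι c : Set (ι → F)) Φ w := by
  obtain ⟨κ, hκ, -, hκ'⟩ := hE.smooth Φ hΦ
  obtain ⟨f₀, hf₀⟩ := hJ.nondegenerate w hw
  obtain ⟨f, hf⟩ : ∃ f : ι → F, (f ᵥ* J) ⬝ᵥ w = 1 :=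
    ⟨((f₀ ᵥ* J) ⬝ᵥ w)⁻¹ • f₀, by
      rw [Matrix.smul_vecMul, smul_dotProduct, smul_eq_mul, inv_mul_cancel₀ hf₀]⟩
  obtain ⟨C, hC0, hC⟩ := exists_valuation_entry_le J
  obtain ⟨D, ⟨hD0, hD1⟩, hDf⟩ := ((eventually_ne_zero_atLarge.and
    (eventually_atLarge (1 : F))).and (eventually_mem_box f)).exists
  rw [map_one] at hD1
  -- Parameters bounded by r fix Φ (r ≤ κ) and preserve boxes (r C ≤ 1).
  obtain ⟨r, hr, hrκ, hrC⟩ := exists_min_valuation hκ (inv_ne_zero hC0)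
  have hrC' : valuation F r * valuation F C ≤ 1 := by
    rw [map_inv₀] at hrC
    have h0 : 0 < valuation F C := zero_lt_iff.2 (by simpa using hC0)
    calc _ ≤ (valuation F C)⁻¹ * valuation F C := by gcongr
      _ = 1 := inv_mul_cancel₀ h0.ne'
  -- As D bounds f, the first transvection has size at most |s D²| = |r|. The second has scalar of
  -- size |s|⁻¹ and vector bounded by s D, so its size is again at most |r|.
  set s : F := r / (D * D) with hs
  have hs0 : s ≠ 0 := div_ne_zero hr (mul_ne_zero hD0 hD0)
  have hsD : s * D * D = r := by rw [hs]; field_simp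
  have hvs : 0 < valuation F s := zero_lt_iff.2 (by simpa using hs0)
  -- For x in this box, the pairing of w + x with z is -s plus a strictly smaller term, so it has
  -- the valuation of s.
  obtain ⟨δ₁, hδ₁, h1⟩ := exists_box_subset (ι := ι) (F := F)
    (U := {x | valuation F ((x ᵥ* J) ⬝ᵥ w + s * ((x ᵥ* J) ⬝ᵥ f)) < valuation F s}) (by
      have hcont : Continuous fun x : ι → F => (x ᵥ* J) ⬝ᵥ w + s * ((x ᵥ* J) ⬝ᵥ f) := by
        have h : ∀ v : ι → F, Continuous fun x : ι → F => (x ᵥ* J) ⬝ᵥ v := fun v =>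
          Continuous.dotProduct (Continuous.matrix_vecMul continuous_id continuous_const)
            continuous_const
        have h1 := h w
        have h2 := h f
        fun_prop
      have h0 : Tendsto (fun x : ι → F => (x ᵥ* J) ⬝ᵥ w + s * ((x ᵥ* J) ⬝ᵥ f)) (𝓝 0) (𝓝 0) :=
        hcont.tendsto' 0 0 (by simp)
      exact h0 <| (IsValuativeTopology.hasBasis_nhds_zero' F).mem_of_mem hvs.ne')
  obtain ⟨δ, hδ, hδ1, hδs⟩ := exists_min_valuation hδ₁ hs0
  refine ⟨δ, hδ, fun x hx c => ?_⟩
  have small : ∀ a : ι → F, ∀ t : F, (∀ i j, valuation F (t * a i * a j) ≤ valuation F r) →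
      ∀ w, fint m ψ (box ι c : Set (ι → F)) Φ (transv J a t w) = fint m ψ (box ι c : Set (ι → F)) Φ w := fun a t h w =>
    fint_transv_of_small m hJ hC (fun i j => (mul_le_mul_left (h i j) _).trans hrC')
      (hκ' a t fun i j => (h i j).trans hrκ) w c
  have hz : w + s • f = transv J f s w := by rw [transv, hf, mul_one]
  set z := w + s • f with hzdef
  have hω : ((w + x) ᵥ* J) ⬝ᵥ z = -s + ((x ᵥ* J) ⬝ᵥ w + s * ((x ᵥ* J) ⬝ᵥ f)) := by
    rw [hzdef, Matrix.add_vecMul, add_dotProduct, dotProduct_add, dotProduct_add, hJ.alternating,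
      dotProduct_smul, dotProduct_smul, hJ.skew w f, hf]
    simp only [smul_eq_mul]; ring
  have hvω : valuation F (((w + x) ᵥ* J) ⬝ᵥ z) = valuation F s := by
    rw [hω, (valuation F).map_add_eq_of_lt_left, Valuation.map_neg]
    rw [Valuation.map_neg]
    exact h1 (box_mono hδ1 hx)
  have hne : ((w + x) ᵥ* J) ⬝ᵥ z ≠ 0 := by
    rw [← (valuation F).ne_zero_iff, hvω]; exact hvs.ne'
  rw [← transv_sub_eq hJ hne, small, hz, small]
  · intro i j
    rw [← hsD]
    simp only [map_mul]
    gcongr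
    exacts [hDf i, hDf j]
  · have ha : ∀ i, valuation F ((w + x - z) i) ≤ valuation F (s * D) := by
      intro i
      have : (w + x - z) i = x i - s * f i := by simp [hzdef]
      rw [this]
      refine (valuation F).map_sub_le ?_ ?_
      · rw [map_mul]
        exact ((hx i).trans hδs).trans (le_mul_of_one_le_right' hD1)
      · rw [map_mul, map_mul]
        gcongr
        exact hDf i
    intro i j
    rw [map_mul, map_mul, map_inv₀, hvω, ← hsD]
    calc _ ≤ (valuation F s)⁻¹ * valuation F (s * D) * valuation F (s * D) := by
          gcongr
          exacts [ha i, ha j]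
      _ = _ := by
        simp only [map_mul]
        field_simp

end StableIntegral

/-! ### Stabilization of the coefficients and Fourier uniqueness. -/

section StableFunctional

variable {F : Type*} [Field F] [ValuativeRel F] [TopologicalSpace F] [IsNonarchimedeanLocalField F]
  {ι : Type*} [Fintype ι] {J : Matrix ι ι F} {E : Submodule ℂ ((ι → F) → ℂ)} {ψ : AddChar F ℂ}

theorem isClopen_box {c : F} (hc : c ≠ 0) : IsClopen (box ι c : Set (ι → F)) :=
  ⟨isClosed_box hc, isOpen_box hc⟩

theorem exists_box_forall_transv_mem (a : ι → F) (t : F) {δ : F} (hδ : δ ≠ 0) :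
    ∃ δ' : F, δ' ≠ 0 ∧ ∀ x ∈ box ι δ', transv J a t x ∈ box ι δ := by
  have h0 : Tendsto (transv J a t) (𝓝 0) (𝓝 0) :=
    (continuous_transv a t).tendsto' 0 0 (by simp [transv])
  exact exists_box_subset (h0 ((isOpen_box hδ).mem_nhds (zero_mem (box ι δ))))

variable [MeasurableSpace (ι → F)] [BorelSpace (ι → F)] (m : Measure (ι → F))
  [m.IsAddHaarMeasure]

/-- Fourier uniqueness at the origin. -/
theorem eq_zero_of_fint_eq_zero (hψ : Continuous ψ) (hψ1 : ψ ≠ 1) {Φ : (ι → F) → ℂ} {κ c : F}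
    (hκ : κ ≠ 0) (hc : c ≠ 0) (hΦ : ∀ y, ∀ u ∈ box ι κ, Φ (y + u) = Φ y)
    (h : ∀ w, fint m ψ (box ι c : Set (ι → F)) Φ w = 0) : Φ 0 = 0 := by
  obtain ⟨t, ht0, ht⟩ := exists_ne_one_of_ne_one hψ1
  obtain ⟨r, hr, hrκ, hrc⟩ := exists_min_valuation hκ hc
  have hδ : t / r ≠ 0 := div_ne_zero ht0 hr
  -- The radius t / r makes the annihilator lie where Φ equals Φ 0, so averaging the vanishing
  -- coefficients gives a positive volume times Φ 0.
  have hsub : boxPerp ι ψ (t / r) ≤ box ι r := by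
    have := boxPerp_subset_box (ι := ι) hδ ht
    rwa [div_div_cancel₀ ht0] at this
  have key := fint_eq_of_forall_add m hψ (continuous_of_periodic hκ hΦ) hδ (isCompact_box c)
    (isClopen_box hc) (w := 0) (A := 0) fun x _ => h _
  have hsub' : (boxPerp ι ψ (t / r) : Set (ι → F)) ⊆ box ι c := fun y hy => box_mono hrc (hsub hy)
  have ho := isOpen_boxPerp (ι := ι) hψ hδ
  rw [Set.inter_eq_right.2 hsub', setIntegral_congr_fun (g := fun _ => Φ 0) ho.measurableSet] at key
  · rw [setIntegral_const, Complex.real_smul] at key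
    refine (mul_eq_zero.1 key.symm).resolve_left ?_
    have : m.real (boxPerp ι ψ (t / r) : Set (ι → F)) ≠ 0 := by
      rw [measureReal_def, ENNReal.toReal_ne_zero]
      exact ⟨(ho.measure_pos m ⟨0, zero_mem (boxPerp ι ψ (t / r))⟩).ne',
        (isCompact_boxPerp hψ hψ1 hδ).measure_lt_top.ne⟩
    exact_mod_cast this
  · intro y hy
    simp only [zero_dotProduct, neg_zero, AddChar.map_zero_eq_one, one_mul]
    rw [← hΦ 0 y (box_mono hrκ (hsub hy)), zero_add]

theorem fint_translate {Φ : (ι → F) → ℂ} {y₀ : ι → F} {c : F} (hc : c ≠ 0) (hy₀ : y₀ ∈ box ι c)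
    (w : ι → F) :
    fint m ψ (box ι c : Set (ι → F)) (fun y => Φ (y + y₀)) w =
      ψ (w ⬝ᵥ y₀) * fint m ψ (box ι c : Set (ι → F)) Φ w := by
  have hm := (isOpen_box (ι := ι) hc).measurableSet
  rw [fint, fint, ← integral_const_mul, ← integral_indicator hm, ← integral_indicator hm]
  conv_rhs => rw [← integral_add_right_eq_self _ y₀]
  refine integral_congr_ae (Eventually.of_forall fun y => ?_)
  have hmem : y + y₀ ∈ (box ι c : Set (ι → F)) ↔ y ∈ (box ι c : Set (ι → F)) :=
    AddSubgroup.add_mem_cancel_right _ hy₀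
  by_cases hy : y ∈ (box ι c : Set (ι → F))
  · simp only [Set.indicator_of_mem (hmem.2 hy), Set.indicator_of_mem hy]
    rw [← mul_assoc, ← AddChar.map_add_eq_mul, dotProduct_add]
    congr 2; ring
  · simp only [Set.indicator_of_notMem (fun h => hy (hmem.1 h)), Set.indicator_of_notMem hy]

/-- A periodic function has no Fourier coefficients at large frequencies. -/
theorem fint_eq_zero_of_notMem_box {Φ : (ι → F) → ℂ} {κ c t : F} (hκ : κ ≠ 0) (hc : c ≠ 0)
    (hκc : valuation F κ ≤ valuation F c) (hΦ : ∀ y, ∀ u ∈ box ι κ, Φ (y + u) = Φ y)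
    (ht : ψ t ≠ 1) {w : ι → F} (hw : w ∉ box ι (t / κ)) :
    fint m ψ (box ι c : Set (ι → F)) Φ w = 0 := by
  classical
  have hw' : w ∉ boxPerp ι ψ κ := fun h => hw (boxPerp_subset_box hκ ht h)
  obtain ⟨u, hu, hne⟩ : ∃ u ∈ box ι κ, ψ (u ⬝ᵥ w) ≠ 1 := by
    by_contra! h; exact hw' h
  have h1 := fint_translate m (ψ := ψ) (Φ := Φ) hc (box_mono hκc hu) w
  have h2 : (fun y => Φ (y + u)) = Φ := funext fun y => hΦ y u hu
  rw [h2, dotProduct_comm] at h1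
  have h3 : (1 - ψ (u ⬝ᵥ w)) * fint m ψ (box ι c : Set (ι → F)) Φ w = 0 := by
    rw [sub_mul, one_mul, ← h1, sub_self]
  exact (mul_eq_zero.1 h3).resolve_left (sub_ne_zero.2 hne.symm)

variable [m.Regular]

theorem exists_eventually_fint_eq (hψ : Continuous ψ) (hψ1 : ψ ≠ 1) (hJ : IsSymplecticGram J)
    (hE : IsShearStable J E) {Φ : (ι → F) → ℂ} (hΦ : Φ ∈ E) {w : ι → F} (hw : w ≠ 0) :
    ∃ δ₀ : F, δ₀ ≠ 0 ∧ ∀ δ : F, δ ≠ 0 → valuation F δ ≤ valuation F δ₀ →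
      ∀ᶠ c in atLarge F, fint m ψ (box ι c : Set (ι → F)) Φ w =
        ∫ y in (boxPerp ι ψ δ : Set (ι → F)), ψ (-(w ⬝ᵥ y)) * Φ y ∂m := by
  obtain ⟨δ₀, hδ₀, h⟩ := exists_fint_add_eq m (ψ := ψ) hJ hE hΦ hw
  refine ⟨δ₀, hδ₀, fun δ hδ hle => ?_⟩
  filter_upwards [eventually_ne_zero_atLarge, eventually_subset_box (isCompact_boxPerp (ι := ι) hψ hψ1 hδ)]
    with c hc hsub
  rw [fint_eq_of_forall_add m hψ (hE.continuous hΦ) hδ (isCompact_box c) (isClopen_box hc)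
    fun x hx => h x (box_mono hle hx) c, Set.inter_eq_right.2 hsub]

/-- The change of variables turns the box into a sheared box. Local constancy reduces the integrals
over both domains to the same `boxPerp`, so the domain is immaterial for large c. -/
theorem eventually_fint_transv_eq (hψ : Continuous ψ) (hψ1 : ψ ≠ 1) (hJ : IsSymplecticGram J)
    (hE : IsShearStable J E) {Φ : (ι → F) → ℂ} (hΦ : Φ ∈ E) {w : ι → F} (hw : w ≠ 0)
    (a : ι → F) (t : F) :
    ∀ᶠ c in atLarge F, fint m ψ (box ι c : Set (ι → F)) Φ (transv J a t w) =
      fint m ψ (box ι c : Set (ι → F)) (Φ ∘ shear J a (-t)) w := by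
  have hΦ₁ := hE.shear Φ hΦ a (-t)
  set Φ₁ := Φ ∘ shear J a (-t) with hΦ₁def
  have hcomp : Φ₁ ∘ shear J a t = Φ := by
    ext y; simp [hΦ₁def, hJ.shear_neg_shear]
  obtain ⟨δ₁, hδ₁, h1⟩ := exists_eventually_fint_eq m hψ hψ1 hJ hE hΦ₁ hw
  obtain ⟨δ₂, hδ₂, h2⟩ := exists_fint_add_eq m (ψ := ψ) hJ hE hΦ (hJ.transv_ne_zero a t hw)
  obtain ⟨δ₃, hδ₃, h3⟩ := exists_box_forall_transv_mem (J := J) a t hδ₂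
  obtain ⟨δ, hδ, hδ1, hδ3⟩ := exists_min_valuation hδ₁ hδ₃
  have hP := isCompact_boxPerp (ι := ι) hψ hψ1 hδ
  filter_upwards [eventually_ne_zero_atLarge, h1 δ hδ hδ1,
    eventually_subset_box (hP.image (continuous_shear (J := J) a (-t)))] with c hc h4 h5
  rw [h4]
  let Λ : Set (ι → F) := shear J a (-t) ⁻¹' (box ι c : Set (ι → F))
  have hΛ : shear J a t ⁻¹' Λ = (box ι c : Set (ι → F)) := by
    ext y; simp [Λ, hJ.shear_neg_shear]
  have hΛc : IsCompact Λ :=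
    (shearEquiv hJ a (-t)).toHomeomorph.isCompact_preimage.2 (isCompact_box c)
  have hΛo : IsClopen Λ := (isClopen_box hc).preimage (continuous_shear a (-t))
  have key := fint_eq_of_forall_add m hψ (hE.continuous hΦ₁) hδ hΛc hΛo (w := w)
    (A := fint m ψ (box ι c : Set (ι → F)) Φ (transv J a t w)) fun x hx => by
      rw [← h2 _ (h3 x (box_mono hδ3 hx)) c, ← transv_add, ← fint_shear m hJ ψ Λ Φ₁ a t, hΛ, hcomp]
  rw [key, Set.inter_eq_right.2]
  exact Set.image_subset_iff.1 h5

/-- If the stable Fourier coefficients of all members of `E` vanish at all nonzero frequencies,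
then the members of `E` are constant. -/
theorem eq_const_of_eventually_fint_eq_zero (hψ : Continuous ψ) (hψ1 : ψ ≠ 1)
    (hJ : IsSymplecticGram J) (hE : IsShearStable J E)
    (h : ∀ Φ ∈ E, ∀ w ≠ 0, ∀ᶠ c in atLarge F, fint m ψ (box ι c : Set (ι → F)) Φ w = 0)
    {Φ : (ι → F) → ℂ} (hΦ : Φ ∈ E) (y₀ : ι → F) : Φ y₀ = Φ 0 := by
  have hΦ' := hE.translate Φ hΦ y₀
  -- Over boxes containing y₀, the coefficient of this difference at w is ψ(w · y₀) - 1 times that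
  -- of Φ. It vanishes for w near 0, where stabilization is unavailable.
  have hΨ : (fun y => Φ (y + y₀)) - Φ ∈ E := E.sub_mem hΦ' hΦ
  set Ψ : (ι → F) → ℂ := (fun y => Φ (y + y₀)) - Φ with hΨdef
  obtain ⟨κ, hκ, hper, -⟩ := hE.smooth Ψ hΨ
  obtain ⟨t, -, ht⟩ := exists_ne_one_of_ne_one hψ1
  obtain ⟨η, hη, hη'⟩ : ∃ η : F, η ≠ 0 ∧ (box ι η : Set (ι → F)) ⊆ {w | ψ (w ⬝ᵥ y₀) = 1} := by
    refine exists_box_subset ?_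
    obtain ⟨γ, hγ, hγ'⟩ := exists_trivial_ball hψ
    have hcont : Continuous fun w : ι → F => w ⬝ᵥ y₀ :=
      Continuous.dotProduct continuous_id continuous_const
    have h0 : Tendsto (fun w : ι → F => w ⬝ᵥ y₀) (𝓝 0) (𝓝 0) := hcont.tendsto' 0 0 (by simp)
    refine mem_of_superset (h0 ((isOpen_ball hγ).mem_nhds (by simp))) fun w hw => hγ' _ hw
  -- Periodicity disposes of frequencies outside the large box. On the remaining compact set,
  -- uniform local constancy yields one c good for all w.
  let C : Set (ι → F) := (box ι (t / κ) : Set (ι → F)) \ box ι η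
  have hC : IsCompact C := (isCompact_box _).diff (isOpen_box hη)
  have hCev : ∀ᶠ c in atLarge F, ∀ w ∈ C, fint m ψ (box ι c : Set (ι → F)) Ψ w = 0 := by
    let p : Set (ι → F) → Prop := fun s =>
      ∀ᶠ c in atLarge F, ∀ w ∈ s, fint m ψ (box ι c : Set (ι → F)) Ψ w = 0
    refine hC.induction_on (p := p)
      (by simp [p]) (fun s u hsu hu => hu.mono fun c hc w hw => hc w (hsu hw))
      (fun s u hs hu => (hs.and hu).mono fun c hc w hw => hw.elim (hc.1 w) (hc.2 w)) fun w hw => ?_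
    have hw0 : w ≠ 0 := by
      rintro rfl
      exact hw.2 (zero_mem (box ι η))
    obtain ⟨δ, hδ, hδ'⟩ := exists_fint_add_eq m (ψ := ψ) hJ hE hΨ hw0
    refine ⟨w +ᵥ (box ι δ : Set (ι → F)), mem_nhdsWithin_of_mem_nhds
      (((isOpen_box hδ).vadd w).mem_nhds ⟨0, zero_mem (box ι δ), by simp⟩), ?_⟩
    change ∀ᶠ c in atLarge F, ∀ w ∈ _, fint m ψ (box ι c : Set (ι → F)) Ψ w = 0
    filter_upwards [h Ψ hΨ w hw0] with c hc
    rintro _ ⟨x, hx, rfl⟩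
    exact (hδ' x hx c).trans hc
  obtain ⟨c, ⟨⟨hc, hκc⟩, hyc⟩, hCc⟩ := (((eventually_ne_zero_atLarge.and
    (eventually_atLarge κ)).and (eventually_mem_box y₀)).and hCev).exists
  have hall : ∀ w, fint m ψ (box ι c : Set (ι → F)) Ψ w = 0 := by
    intro w
    by_cases hw1 : w ∈ box ι (t / κ)
    · by_cases hw2 : w ∈ box ι η
      · have hint := fun {f : (ι → F) → ℂ} (hf : f ∈ E) => integrableOn_addChar_mul m hψ
          (hE.continuous hf) (isCompact_box c) (isOpen_box hc).measurableSet w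
        have h1 := fint_translate m (ψ := ψ) (Φ := Φ) hc hyc w
        rw [show ψ (w ⬝ᵥ y₀) = 1 from hη' hw2, one_mul] at h1
        rw [fint, fint] at h1
        rw [fint]
        simp only [hΨdef, Pi.sub_apply, mul_sub]
        rw [integral_sub (hint hΦ') (hint hΦ), h1, sub_self]
      · exact hCc w ⟨hw1, hw2⟩
    · exact fint_eq_zero_of_notMem_box m hκ hc hκc hper ht hw1
  have := eq_zero_of_fint_eq_zero m hψ hψ1 hκ hc hper hall
  simpa [hΨdef, sub_eq_zero] using this

end StableFunctional

/-! ### The stable Fourier coefficient as a functional. -/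

section Functional

variable {F : Type*} [Field F] [ValuativeRel F] [TopologicalSpace F] [IsNonarchimedeanLocalField F]
  {ι : Type*} [Fintype ι] {J : Matrix ι ι F} {E : Submodule ℂ ((ι → F) → ℂ)} {ψ : AddChar F ℂ}

/-- Either the shear-stable space `E` consists of constant functions, or it carries a nonzero
functional that transforms under translations by the character `y ↦ ψ (e ⬝ᵥ y)` and is invariant
under the shears fixing this character. -/
theorem IsShearStable.exists_functional (hψ : Continuous ψ) (hψ1 : ψ ≠ 1)
    (hJ : IsSymplecticGram J) (hE : IsShearStable J E) {e : ι → F} (he : e ≠ 0) :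
    (∀ Φ ∈ E, ∀ y, Φ y = Φ 0) ∨
    ∃ L : E →ₗ[ℂ] ℂ, L ≠ 0 ∧
      (∀ Φ : E, ∀ y₀, L ⟨_, hE.translate Φ Φ.2 y₀⟩ = ψ (e ⬝ᵥ y₀) * L Φ) ∧
      ∀ Φ : E, ∀ a t, (a ᵥ* J) ⬝ᵥ e = 0 → L ⟨_, hE.shear Φ Φ.2 a t⟩ = L Φ := by
  let _ : MeasurableSpace (ι → F) := borel _
  have _ : BorelSpace (ι → F) := ⟨rfl⟩
  let m : Measure (ι → F) := Measure.addHaar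
  let I : (ι → F) → ((ι → F) → ℂ) → F → ℂ := fun w Φ c => fint m ψ (box ι c : Set (ι → F)) Φ w
  -- On E the coefficients are eventually constant, so this limit is attained and its properties can
  -- be checked at a single large c.
  let Lf : ((ι → F) → ℂ) → ℂ := fun Φ => limUnder (atLarge F) (I e Φ)
  have lim_eq : ∀ {Φ A}, (∀ᶠ c in atLarge F, I e Φ c = A) → Lf Φ = A := fun {Φ A} hA =>
    Tendsto.limUnder_eq (tendsto_const_nhds.congr' (hA.mono fun c hc => hc.symm))
  have ev : ∀ Φ ∈ E, ∀ᶠ c in atLarge F, I e Φ c = Lf Φ := fun Φ hΦ => by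
    obtain ⟨δ, hδ, h⟩ := exists_eventually_fint_eq m hψ hψ1 hJ hE hΦ he
    have h' := h δ hδ le_rfl
    exact h'.mono fun c hc => hc.trans (lim_eq h').symm
  have hint : ∀ Φ ∈ E, ∀ c : F, c ≠ 0 → _ := fun Φ hΦ c hc =>
    integrableOn_addChar_mul m hψ (hE.continuous hΦ) (isCompact_box c)
      (isOpen_box hc).measurableSet e
  let L : E →ₗ[ℂ] ℂ :=
    { toFun := fun Φ => Lf Φ
      map_add' := fun Φ Ψ => lim_eq <| by
        filter_upwards [ev Φ Φ.2, ev Ψ Ψ.2, eventually_ne_zero_atLarge] with c h1 h2 hc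
        rw [← h1, ← h2]
        simp only [I, fint, Submodule.coe_add, Pi.add_apply, mul_add]
        exact integral_add (hint Φ Φ.2 c hc) (hint Ψ Ψ.2 c hc)
      map_smul' := fun r Φ => lim_eq <| by
        filter_upwards [ev Φ Φ.2] with c h1
        rw [← h1]
        simp only [I, fint, Submodule.coe_smul, Pi.smul_apply, smul_eq_mul, RingHom.id_apply,
          ← integral_const_mul]
        refine integral_congr_ae (Eventually.of_forall fun y => ?_)
        ring }
  by_cases hL : L = 0
  · left
    intro Φ hΦ y
    have hzero : ∀ Φ ∈ E, ∀ᶠ c in atLarge F, I e Φ c = 0 := fun Φ hΦ => by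
      have h0 : Lf Φ = 0 := congrArg (fun T : E →ₗ[ℂ] ℂ => T ⟨Φ, hΦ⟩) hL
      simpa only [h0] using ev Φ hΦ
    refine eq_const_of_eventually_fint_eq_zero m hψ hψ1 hJ hE (fun Φ hΦ w hw => ?_) hΦ y
    -- Transitivity transports vanishing at e to every nonzero w, because E is stable under shears.
    obtain ⟨a₁, t₁, a₂, t₂, rfl⟩ := exists_transv_transv_eq hJ he hw
    have hΦ₂ := hE.shear Φ hΦ a₂ (-t₂)
    filter_upwards [eventually_fint_transv_eq m hψ hψ1 hJ hE hΦ (hJ.transv_ne_zero a₁ t₁ he) a₂ t₂,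
      eventually_fint_transv_eq m hψ hψ1 hJ hE hΦ₂ he a₁ t₁,
      hzero _ (hE.shear _ hΦ₂ a₁ (-t₁))] with c h1 h2 h3
    rw [h1, h2]
    exact h3
  · right
    refine ⟨L, hL, fun Φ y₀ => lim_eq ?_, fun Φ a t hat => lim_eq ?_⟩
    · filter_upwards [ev Φ Φ.2, eventually_ne_zero_atLarge, eventually_mem_box y₀] with c h1 hc hy
      exact (fint_translate m hc hy e).trans (congrArg _ h1)
    · have hfix : transv J a (-t) e = e := by simp [transv, hat]
      filter_upwards [ev Φ Φ.2, eventually_fint_transv_eq m hψ hψ1 hJ hE Φ.2 he a (-t)]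
        with c h1 h2
      rw [hfix, neg_neg] at h2
      exact h2.symm.trans h1

end Functional

/-! ### From functionals on functions to forms on the representation. -/

section EquivariantForm

variable {F : Type*} [Field F] [ValuativeRel F] [TopologicalSpace F] [IsNonarchimedeanLocalField F]
  {ι : Type*} [Fintype ι] {J : Matrix ι ι F} {ψ : AddChar F ℂ} {V : Type*} [AddCommGroup V]
  [Module ℂ V]

/-- A form invariant under transvections that act by shears on a vector group yields a
form that transforms under the vector group by the character `y ↦ ψ (ε * (e ⬝ᵥ y))`, where
`ε` is `0` or `1`. -/
theorem exists_equivariant_form (hψ : Continuous ψ) (hψ1 : ψ ≠ 1) (hJ : IsSymplecticGram J)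
    {e : ι → F} (he : e ≠ 0) (β : (ι → F) → V →ₗ[ℂ] V) (τ : (ι → F) → F → V →ₗ[ℂ] V)
    {l : V →ₗ[ℂ] ℂ} (hl : l ≠ 0) (hβ0 : ∀ v, l (β 0 v) = l v)
    (hβ : ∀ y y₀ v, l (β y (β y₀ v)) = l (β (y + y₀) v))
    (hτ : ∀ a t y v, l (β y (τ a t v)) = l (β (shear J a t y) v))
    (hsmooth : ∀ v, ∃ κ : F, κ ≠ 0 ∧ (∀ u ∈ box ι κ, β u v = v) ∧
      ∀ a t, (∀ i j, valuation F (t * a i * a j) ≤ valuation F κ) → τ a t v = v) :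
    ∃ ε : F, (ε = 0 ∨ ε = 1) ∧ ∃ l' : V →ₗ[ℂ] ℂ, l' ≠ 0 ∧
      (∀ y v, l' (β y v) = ψ (ε * (e ⬝ᵥ y)) * l' v) ∧
      (∀ v v' : V, ∀ c : ℂ, (∀ y, l (β y v') = c * l (β y v)) → l' v' = c * l' v) ∧
      ∀ a t, (a ᵥ* J) ⬝ᵥ e = 0 → ∀ v, l' (τ a t v) = l' v := by
  let Φ : V →ₗ[ℂ] ((ι → F) → ℂ) := LinearMap.pi fun y => l ∘ₗ β y
  let E := LinearMap.range Φ
  have htr : ∀ v y₀, (fun y => Φ v (y + y₀)) = Φ (β y₀ v) := fun v y₀ =>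
    funext fun y => (hβ y y₀ v).symm
  have hsh : ∀ v a t, Φ v ∘ shear J a t = Φ (τ a t v) := fun v a t =>
    funext fun y => (hτ a t y v).symm
  have hE : IsShearStable J E := by
    constructor
    · rintro _ ⟨v, rfl⟩ y₀
      exact ⟨β y₀ v, (htr v y₀).symm⟩
    · rintro _ ⟨v, rfl⟩ a t
      exact ⟨τ a t v, (hsh v a t).symm⟩
    · rintro _ ⟨v, rfl⟩
      obtain ⟨κ, hκ, h1, h2⟩ := hsmooth v
      refine ⟨κ, hκ, fun y u hu => ?_, fun a t h => ?_⟩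
      · rw [show Φ v (y + u) = Φ (β u v) y from congrFun (htr v u) y, h1 u hu]
      · rw [hsh, h2 a t h]
  -- Constant functions keep l itself; otherwise the functional is pulled back along Φ. Either way
  -- proportional functions give proportional values, which is how old equivariance will be
  -- inherited.
  rcases hE.exists_functional hψ hψ1 hJ he with hconst | ⟨L, hL, h1, h2⟩
  · have hc : ∀ y v, l (β y v) = l v := fun y v =>
      (hconst (Φ v) ⟨v, rfl⟩ y).trans (hβ0 v)
    refine ⟨0, Or.inl rfl, l, hl, fun y v => ?_, fun v v' c h => ?_, fun a t _ v => ?_⟩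
    · rw [hc, zero_mul, AddChar.map_zero_eq_one, one_mul]
    · simpa only [hβ0] using h 0
    · rw [← hβ0, hτ, hc]
  · refine ⟨1, Or.inr rfl, L ∘ₗ Φ.rangeRestrict, ?_, fun y v => ?_, fun v v' c h => ?_,
      fun a t ha v => ?_⟩
    · intro h0
      refine hL (LinearMap.ext ?_)
      rintro ⟨_, v, rfl⟩
      exact congrArg (fun T : V →ₗ[ℂ] ℂ => T v) h0
    · rw [one_mul, LinearMap.comp_apply, LinearMap.comp_apply, ← h1]
      exact congrArg L (Subtype.ext (htr v y).symm)
    · have : Φ.rangeRestrict v' = c • Φ.rangeRestrict v := Subtype.ext (funext h)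
      rw [LinearMap.comp_apply, this, map_smul, smul_eq_mul, LinearMap.comp_apply]
    · rw [LinearMap.comp_apply, LinearMap.comp_apply, ← h2 (Φ.rangeRestrict v) a t ha]
      exact congrArg L (Subtype.ext (hsh v a t).symm)

end EquivariantForm

/-! ### The symplectic Gram matrix. -/

section Gram

variable {n : ℕ} {F : Type*} [Field F]

theorem gram_apply (i j : Fin (2 * n)) :
    gram n F i j = if i = j.rev then (if (i : ℕ) < n then 1 else -1) else 0 := by
  have : (i : ℕ) + j + 1 = 2 * n ↔ i = j.rev := by
    rw [Fin.ext_iff, Fin.val_rev]; omega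
  simp only [gram, Matrix.of_apply, this]

theorem rev_lt_iff (j : Fin (2 * n)) : ((j.rev : Fin (2 * n)) : ℕ) < n ↔ ¬ (j : ℕ) < n := by
  rw [Fin.val_rev]; omega

theorem vecMul_gram (a : Fin (2 * n) → F) (j : Fin (2 * n)) :
    (a ᵥ* gram n F) j = if (j : ℕ) < n then -a j.rev else a j.rev := by
  rw [Matrix.vecMul, dotProduct, Finset.sum_eq_single j.rev]
  · rw [gram_apply, if_pos rfl]
    by_cases hj : (j : ℕ) < n <;> simp [rev_lt_iff, hj, -Fin.val_rev]
  · intro i _ hi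
    rw [gram_apply, if_neg hi, mul_zero]
  · simp

/-- The terms at i and `i.rev` cancel in pairs, so no division by 2 occurs and characteristic 2 is
covered. -/
theorem vecMul_gram_dotProduct_self (a : Fin (2 * n) → F) : (a ᵥ* gram n F) ⬝ᵥ a = 0 := by
  refine Finset.sum_involution (fun i _ => i.rev) (fun i _ => ?_) (fun i _ _ h => ?_)
    (fun i _ => Finset.mem_univ _) (fun i _ => Fin.rev_rev i)
  · rw [vecMul_gram, vecMul_gram, Fin.rev_rev]
    by_cases hi : (i : ℕ) < n <;> simp [rev_lt_iff, hi, -Fin.val_rev, mul_comm]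
  · have := congrArg Fin.val h
    rw [Fin.val_rev] at this
    omega

theorem gram_mulVec (a : Fin (2 * n) → F) : gram n F *ᵥ a = -(a ᵥ* gram n F) := by
  have : (gram n F)ᵀ = -gram n F := by
    ext i j
    rw [Matrix.transpose_apply, Matrix.neg_apply, gram_apply, gram_apply]
    by_cases hij : i = j.rev
    · subst hij
      by_cases hj : (j : ℕ) < n <;> simp [rev_lt_iff, hj, -Fin.val_rev]
    · have hij' : j ≠ i.rev := fun h => hij (by rw [h, Fin.rev_rev])
      simp [hij, hij']
  rw [← Matrix.vecMul_transpose, this, Matrix.vecMul_neg]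

end Gram

/-! ### Rank-one elements and transvections in the special linear group. -/

section RankOne

variable {N : Type*} [Fintype N] [DecidableEq N] {R : Type*} [CommRing R]

/-- The element `1 + u φᵀ` of the special linear group, for orthogonal vectors `u` and `φ`. -/
def rankOne (u φ : N → R) (h : φ ⬝ᵥ u = 0) : Matrix.SpecialLinearGroup N R :=
  ⟨1 + Matrix.vecMulVec u φ, by
    rw [Matrix.vecMulVec_eq Unit, Matrix.det_one_add_replicateCol_mul_replicateRow, h, add_zero]⟩

@[simp]
theorem coe_rankOne (u φ : N → R) (h : φ ⬝ᵥ u = 0) :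
    (rankOne u φ h : Matrix N N R) = 1 + Matrix.vecMulVec u φ := rfl

theorem one_add_vecMulVec_mul (u φ v χ : N → R) :
    (1 + Matrix.vecMulVec u φ) * (1 + Matrix.vecMulVec v χ) =
      1 + Matrix.vecMulVec u φ + Matrix.vecMulVec v χ + (φ ⬝ᵥ v) • Matrix.vecMulVec u χ := by
  rw [add_mul, mul_add, mul_add, Matrix.vecMulVec_mul_vecMulVec, one_mul, mul_one, one_mul,
    Matrix.vecMulVec_smul]
  abel

end RankOne

section Transvection

variable {n : ℕ} {F : Type*} [Field F]

/-- The symplectic transvection `x ↦ x + t ⟨a, x⟩ a`, as an element of `SL(W_n)`. -/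
def sTransv (a : Fin (2 * n) → F) (t : F) : Matrix.SpecialLinearGroup (Fin (2 * n)) F :=
  rankOne a (t • (a ᵥ* gram n F)) (by
    rw [smul_dotProduct, vecMul_gram_dotProduct_self, smul_zero])

theorem coe_sTransv (a : Fin (2 * n) → F) (t : F) :
    (sTransv a t : Matrix (Fin (2 * n)) (Fin (2 * n)) F) =
      1 + t • Matrix.vecMulVec a (a ᵥ* gram n F) := by
  rw [sTransv, coe_rankOne, Matrix.vecMulVec_smul]

theorem sTransv_mem_Sp (a : Fin (2 * n) → F) (t : F) : sTransv a t ∈ Sp n F := by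
  change (sTransv a t : Matrix (Fin (2 * n)) (Fin (2 * n)) F)ᵀ * gram n F *
    (sTransv a t : Matrix (Fin (2 * n)) (Fin (2 * n)) F) = gram n F
  rw [coe_sTransv, Matrix.transpose_add, Matrix.transpose_one, Matrix.transpose_smul,
    Matrix.transpose_vecMulVec, add_mul, one_mul, Matrix.smul_mul, Matrix.vecMulVec_mul, mul_add,
    mul_one, add_mul, Matrix.mul_smul, Matrix.mul_vecMulVec, gram_mulVec, Matrix.mul_smul,
    Matrix.smul_mul, Matrix.vecMulVec_mul_vecMulVec, vecMul_gram_dotProduct_self]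
  simp [Matrix.neg_vecMulVec]

end Transvection

/-! ### The middle block and its symplectic form. -/

section Middle

variable {n : ℕ} {F : Type*} [Field F]

theorem single_vecMul_gram {K : Fin (2 * n)} (hK : (K : ℕ) < n) :
    (Pi.single K 1 : Fin (2 * n) → F) ᵥ* gram n F = Pi.single K.rev 1 := by
  ext j
  rw [vecMul_gram]
  by_cases hj : j = K.rev
  · subst hj
    rw [if_neg (by rw [rev_lt_iff]; exact not_not.2 hK), Fin.rev_rev, Pi.single_eq_same,
      Pi.single_eq_same]
  · have : j.rev ≠ K := fun h => hj (by rw [← h, Fin.rev_rev])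
    simp [hj, this]

/-- The indices of the middle block obtained by removing the first and the last `k + 1`. -/
abbrev Mid (n k : ℕ) := {i : Fin (2 * n) // k < (i : ℕ) ∧ (i : ℕ) + k + 1 < 2 * n}

variable {k : ℕ}

/-- The reflection of the middle block. -/
def Mid.rev (i : Mid n k) : Mid n k :=
  ⟨i.1.rev, by have := i.2; have := Fin.val_rev i.1; omega⟩

theorem Mid.coe_rev (i : Mid n k) : (i.rev : Fin (2 * n)) = (i : Fin (2 * n)).rev := rfl

/-- Extension by zero of a vector supported on the middle block. -/
def extMid (a : Mid n k → F) (i : Fin (2 * n)) : F :=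
  if h : k < (i : ℕ) ∧ (i : ℕ) + k + 1 < 2 * n then a ⟨i, h⟩ else 0

@[simp]
theorem extMid_coe (a : Mid n k → F) (i : Mid n k) : extMid a i = a i := dif_pos i.2

theorem extMid_eq_zero (a : Mid n k → F) {i : Fin (2 * n)}
    (h : ¬ (k < (i : ℕ) ∧ (i : ℕ) + k + 1 < 2 * n)) : extMid a i = 0 := dif_neg h

theorem extMid_zero : extMid (0 : Mid n k → F) = 0 := by
  ext i; simp [extMid]

theorem extMid_add (a b : Mid n k → F) : extMid (a + b) = extMid a + extMid b := by
  ext i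
  by_cases h : k < (i : ℕ) ∧ (i : ℕ) + k + 1 < 2 * n <;> simp [extMid, h]

theorem extMid_smul (c : F) (a : Mid n k → F) : extMid (c • a) = c • extMid a := by
  ext i
  by_cases h : k < (i : ℕ) ∧ (i : ℕ) + k + 1 < 2 * n <;> simp [extMid, h]

theorem extMid_dotProduct (a b : Mid n k → F) : extMid a ⬝ᵥ extMid b = a ⬝ᵥ b := by
  refine (Fintype.sum_of_injective Subtype.val Subtype.val_injective _ _ (fun i hi => ?_)
    fun i => ?_).symm
  · rw [extMid_eq_zero a fun h => hi ⟨⟨i, h⟩, rfl⟩, zero_mul]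
  · rw [extMid_coe, extMid_coe]

/-- The Gram matrix of the restriction of the form to the middle block. -/
def midGram (n k : ℕ) (F : Type*) [Field F] : Matrix (Mid n k) (Mid n k) F :=
  (gram n F).submatrix Subtype.val Subtype.val

theorem vecMul_midGram (a : Mid n k → F) (j : Mid n k) :
    (a ᵥ* midGram n k F) j = if ((j : Fin (2 * n)) : ℕ) < n then -a j.rev else a j.rev := by
  rw [Matrix.vecMul, dotProduct, Finset.sum_eq_single j.rev]
  · rw [midGram, Matrix.submatrix_apply, gram_apply, if_pos (Mid.coe_rev j)]
    by_cases hj : ((j : Fin (2 * n)) : ℕ) < n <;>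
      simp [Mid.coe_rev, rev_lt_iff, hj, -Fin.val_rev]
  · intro i _ hi
    rw [midGram, Matrix.submatrix_apply, gram_apply, 
      if_neg fun h : (i : Fin (2 * n)) = (j : Fin (2 * n)).rev => hi (Subtype.ext h), mul_zero]
  · simp

theorem extMid_vecMul (a : Mid n k → F) :
    extMid (a ᵥ* midGram n k F) = extMid a ᵥ* gram n F := by
  ext j
  rw [vecMul_gram]
  by_cases h : k < (j : ℕ) ∧ (j : ℕ) + k + 1 < 2 * n
  · obtain ⟨j, rfl⟩ : ∃ i : Mid n k, (i : Fin (2 * n)) = j := ⟨⟨j, h⟩, rfl⟩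
    rw [extMid_coe, vecMul_midGram]
    have : extMid a (j : Fin (2 * n)).rev = a (Mid.rev j) := extMid_coe a (Mid.rev j)
    rw [this]
  · have h' : ¬ (k < (j.rev : ℕ) ∧ (j.rev : ℕ) + k + 1 < 2 * n) := by
      rw [Fin.val_rev]; omega
    rw [extMid_eq_zero _ h, extMid_eq_zero _ h']
    simp

theorem isSymplecticGram_midGram : IsSymplecticGram (midGram n k F) where
  alternating a := by
    rw [← extMid_dotProduct, extMid_vecMul, vecMul_gram_dotProduct_self]
  nondegenerate w hw := by
    obtain ⟨i, hi⟩ := Function.ne_iff.1 hw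
    refine ⟨Pi.single i.rev 1, ?_⟩
    rw [dotProduct, Finset.sum_eq_single i]
    · have : Mid.rev i.rev = i := Subtype.ext (Fin.rev_rev _)
      rw [vecMul_midGram]
      by_cases hn : ((i : Fin (2 * n)) : ℕ) < n <;> simpa [hn] using hi
    · intro j _ hj
      have : j.rev ≠ i.rev := fun h => hj (Subtype.ext (Fin.rev_injective (congrArg Subtype.val h)))
      rw [vecMul_midGram]
      simp [this]
    · simp

end Middle

/-! ### Row elements and the Heisenberg group. -/

section Elements

variable {n : ℕ} {F : Type*} [Field F] {k : ℕ}

local notation "𝕄" => Matrix (Fin (2 * n)) (Fin (2 * n)) F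

theorem extMid_dotProduct_single (y : Mid n k → F) {i : Fin (2 * n)} (c : F)
    (h : ¬ (k < (i : ℕ) ∧ (i : ℕ) + k + 1 < 2 * n)) : extMid y ⬝ᵥ Pi.single i c = 0 := by
  rw [dotProduct_single, extMid_eq_zero y h, zero_mul]

theorem single_dotProduct_extMid (y : Mid n k → F) {i : Fin (2 * n)} (c : F)
    (h : ¬ (k < (i : ℕ) ∧ (i : ℕ) + k + 1 < 2 * n)) : Pi.single i c ⬝ᵥ extMid y = 0 := by
  rw [single_dotProduct, extMid_eq_zero y h, mul_zero]

/-- The unipotent element whose only nontrivial row is the one with index `K`, with entries `y` in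
the middle block. -/
def rowElt (K : Fin (2 * n)) (y : Mid n K → F) : Matrix.SpecialLinearGroup (Fin (2 * n)) F :=
  rankOne (Pi.single K 1) (extMid y) (extMid_dotProduct_single y 1 (by omega))

theorem coe_rowElt (K : Fin (2 * n)) (y : Mid n K → F) :
    (rowElt K y : 𝕄) = 1 + Matrix.vecMulVec (Pi.single K 1) (extMid y) := rfl

theorem rowElt_zero (K : Fin (2 * n)) : rowElt K (0 : Mid n K → F) = 1 := by
  refine Subtype.ext ?_
  rw [coe_rowElt, extMid_zero, Matrix.vecMulVec_zero, add_zero]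
  rfl

theorem rowElt_mul (K : Fin (2 * n)) (y y' : Mid n K → F) :
    rowElt K y * rowElt K y' = rowElt K (y + y') := by
  refine Subtype.ext ?_
  rw [Matrix.SpecialLinearGroup.coe_mul, coe_rowElt, coe_rowElt, coe_rowElt,
    one_add_vecMulVec_mul, extMid_dotProduct_single y 1 (by omega), zero_smul, add_zero, extMid_add,
    Matrix.vecMulVec_add, add_assoc]

/-- The source of the shear action: a form invariant under the transvection absorbs the left factor,
leaving only the sheared row. -/
theorem rowElt_mul_sTransv {K : Fin (2 * n)} (y a : Mid n K → F) (t : F) :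
    rowElt K y * sTransv (extMid a) t =
      sTransv (extMid a) t * rowElt K (shear (midGram n K F) a t y) := by
  refine Subtype.ext ?_
  have h0 : (extMid a ᵥ* gram n F) ⬝ᵥ Pi.single K 1 = 0 := by
    rw [← extMid_vecMul]
    exact extMid_dotProduct_single _ 1 (by omega)
  rw [Matrix.SpecialLinearGroup.coe_mul, Matrix.SpecialLinearGroup.coe_mul, coe_rowElt, coe_rowElt,
    coe_sTransv, ← Matrix.vecMulVec_smul, one_add_vecMulVec_mul, one_add_vecMulVec_mul,
    smul_dotProduct, h0, smul_zero, zero_smul, add_zero, extMid_dotProduct, shear, extMid_add,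
    extMid_smul, extMid_vecMul, Matrix.vecMulVec_add, Matrix.vecMulVec_smul, Matrix.vecMulVec_smul,
    Matrix.vecMulVec_smul, smul_smul, mul_comm t]
  abel

/-- The element of the Heisenberg subgroup of `Sp(W_n)` with parameters `w` and `t`. -/
def heis (K : Fin (2 * n)) (w : Mid n K → F) (t : F) :
    Matrix.SpecialLinearGroup (Fin (2 * n)) F :=
  -- As a product of transvections, it preserves any form they preserve. The middle factor already
  -- contributes 1 to the corner, hence t - 1.
  sTransv (Pi.single K 1) (t - 1) * (sTransv (Pi.single K 1 + extMid w) 1 * sTransv (extMid w) (-1))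

theorem coe_heis {K : Fin (2 * n)} (hK : (K : ℕ) < n) (w : Mid n K → F) (t : F) :
    (heis K w t : 𝕄) = 1 + Matrix.vecMulVec (Pi.single K 1) (extMid w ᵥ* gram n F) +
      Matrix.vecMulVec (extMid w) (Pi.single K.rev 1) +
      t • Matrix.vecMulVec (Pi.single K 1) (Pi.single K.rev 1) := by
  have hrev := Fin.val_rev K
  have h2 : (Pi.single K.rev 1 : Fin (2 * n) → F) ⬝ᵥ extMid w = 0 :=
    single_dotProduct_extMid w 1 (by omega)
  have h3 : (extMid w ᵥ* gram n F) ⬝ᵥ extMid w = 0 := vecMul_gram_dotProduct_self _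
  have h4 : (Pi.single K.rev 1 : Fin (2 * n) → F) ⬝ᵥ Pi.single K 1 = 0 := by
    rw [← single_vecMul_gram hK, vecMul_gram_dotProduct_self]
  rw [heis, Matrix.SpecialLinearGroup.coe_mul, Matrix.SpecialLinearGroup.coe_mul, coe_sTransv,
    coe_sTransv, coe_sTransv, Matrix.add_vecMul, single_vecMul_gram hK]
  simp only [mul_add, add_mul, mul_one, one_mul, Matrix.smul_mul, Matrix.mul_smul,
    Matrix.add_vecMulVec, Matrix.vecMulVec_add, Matrix.vecMulVec_mul_vecMulVec, h2, h3, h4,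
    zero_smul, Matrix.vecMulVec_zero, smul_zero, add_zero]
  module

/-- The two commute up to the central parameter t, which a Heisenberg-invariant form does not see.
-/
theorem rowElt_mul_heis {K : Fin (2 * n)} (hK : (K : ℕ) < n) (y w : Mid n K → F) (t : F) :
    rowElt K y * heis K w t = heis K w (t + y ⬝ᵥ w) * rowElt K y := by
  have hrev := Fin.val_rev K
  have h1 : (extMid w ᵥ* gram n F) ⬝ᵥ Pi.single K 1 = 0 := by
    rw [← extMid_vecMul]
    exact extMid_dotProduct_single _ 1 (by omega)
  have h2 : extMid y ⬝ᵥ Pi.single K 1 = 0 := extMid_dotProduct_single y 1 (by omega)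
  have h4 : (Pi.single K.rev 1 : Fin (2 * n) → F) ⬝ᵥ Pi.single K 1 = 0 := by
    rw [← single_vecMul_gram hK, vecMul_gram_dotProduct_self]
  refine Subtype.ext ?_
  rw [Matrix.SpecialLinearGroup.coe_mul, Matrix.SpecialLinearGroup.coe_mul, coe_heis hK,
    coe_heis hK, coe_rowElt]
  simp only [mul_add, add_mul, mul_one, one_mul, Matrix.smul_mul, Matrix.mul_smul,
    Matrix.vecMulVec_mul_vecMulVec, h1, h2, h4, extMid_dotProduct,
    zero_smul, Matrix.vecMulVec_zero, smul_zero, add_zero, Matrix.vecMulVec_smul]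
  module

theorem coe_rowElt_mul_heis {K : Fin (2 * n)} (hK : (K : ℕ) < n) (y w : Mid n K → F) (t : F)
    (i j : Fin (2 * n)) :
    (rowElt K y * heis K w t : Matrix.SpecialLinearGroup (Fin (2 * n)) F) i j =
      (1 : 𝕄) i j + (Pi.single K 1 : Fin (2 * n) → F) i * (extMid y + extMid w ᵥ* gram n F) j +
      extMid w i * (Pi.single K.rev 1 : Fin (2 * n) → F) j +
      (t + y ⬝ᵥ w) * ((Pi.single K 1 : Fin (2 * n) → F) i * (Pi.single K.rev 1 : Fin (2 * n) → F) j)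
      := by
  have h1 : (extMid w ᵥ* gram n F) ⬝ᵥ Pi.single K 1 = 0 := by
    rw [← extMid_vecMul]
    exact extMid_dotProduct_single _ 1 (by omega)
  have h4 : (Pi.single K.rev 1 : Fin (2 * n) → F) ⬝ᵥ Pi.single K 1 = 0 := by
    rw [← single_vecMul_gram hK, vecMul_gram_dotProduct_self]
  rw [rowElt_mul_heis hK, Matrix.SpecialLinearGroup.coe_mul, coe_heis hK, coe_rowElt]
  simp only [mul_add, add_mul, mul_one, one_mul, Matrix.smul_mul,
    Matrix.vecMulVec_mul_vecMulVec, h1, h4, zero_smul, Matrix.vecMulVec_zero, smul_zero, add_zero,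
    Matrix.add_apply, Matrix.smul_apply, Matrix.vecMulVec_apply, Pi.add_apply, smul_eq_mul]
  ring

end Elements

/-! ### Unipotent matrices and the character `mu`. -/

section Unipotent

variable {n : ℕ} {F : Type*} [Field F] {k : ℕ}

/-- The middle block of `X`, obtained by removing the first and the last `k` indices, is the
identity matrix. -/
def IsOuter (k : ℕ) (X : Matrix.SpecialLinearGroup (Fin (2 * n)) F) : Prop :=
  ∀ i j : Fin (2 * n), k ≤ (i : ℕ) → (j : ℕ) + k + 1 ≤ 2 * n →
    X i j = (1 : Matrix (Fin (2 * n)) (Fin (2 * n)) F) i j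

/-- As M⁻¹ is upper triangular, these entries of X M⁻¹ involve only entries of X that agree with
those of M. -/
theorem isOuter_mul_inv {X M : Matrix.SpecialLinearGroup (Fin (2 * n)) F}
    (hM : M ∈ upperUnipotent (2 * n) F)
    (h : ∀ i j : Fin (2 * n), k ≤ (i : ℕ) → (j : ℕ) + k + 1 ≤ 2 * n → X i j = M i j) :
    IsOuter k (X * M⁻¹) := by
  intro i j hi hj
  have hM' := (upperUnipotent (2 * n) F).inv_mem hM
  rw [← Matrix.SpecialLinearGroup.coe_one, ← mul_inv_cancel M, Matrix.SpecialLinearGroup.coe_mul,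
    Matrix.SpecialLinearGroup.coe_mul, Matrix.mul_apply, Matrix.mul_apply]
  refine Finset.sum_congr rfl fun l _ => ?_
  rcases lt_or_ge j l with hl | hl
  · rw [hM'.1 l j hl, mul_zero, mul_zero]
  · rw [h i l hi (by have : (l : ℕ) ≤ j := hl; omega)]

theorem IsOuter.conj {u M : Matrix.SpecialLinearGroup (Fin (2 * n)) F} (hu : IsOuter k u)
    (hM : M ∈ upperUnipotent (2 * n) F) : IsOuter k (M * u * M⁻¹) := by
  refine isOuter_mul_inv hM fun i j hi hj => ?_
  have h1 : (M : Matrix (Fin (2 * n)) (Fin (2 * n)) F) i j =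
      (M * 1 : Matrix.SpecialLinearGroup (Fin (2 * n)) F) i j := by rw [mul_one]
  rw [h1, Matrix.SpecialLinearGroup.coe_mul, Matrix.SpecialLinearGroup.coe_mul, Matrix.mul_apply,
    Matrix.mul_apply]
  refine Finset.sum_congr rfl fun l _ => ?_
  rcases lt_or_ge l i with hl | hl
  · rw [hM.1 i l hl, zero_mul, zero_mul]
  · rw [hu l j (by have : (i : ℕ) ≤ l := hl; omega) hj, Matrix.SpecialLinearGroup.coe_one]

theorem mul_apply_succ {N : ℕ} {X Y : Matrix.SpecialLinearGroup (Fin N) F}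
    (hX : X ∈ upperUnipotent N F) (hY : Y ∈ upperUnipotent N F) {i j : Fin N}
    (hij : (j : ℕ) = i + 1) : (X * Y) i j = X i j + Y i j := by
  have hne : i ≠ j := fun h => by rw [h] at hij; omega
  rw [Matrix.SpecialLinearGroup.coe_mul, Matrix.mul_apply, Finset.sum_eq_add i j hne, hX.2, hY.2,
    one_mul, mul_one, add_comm]
  · intro l _ hl
    rcases lt_or_ge l i with h | h
    · rw [hX.1 i l h, zero_mul]
    · rw [hY.1 l j, mul_zero]
      have h1 : (i : ℕ) ≤ l := h
      have h2 : (l : ℕ) ≠ i := fun h => hl.1 (Fin.ext h)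
      have h3 : (l : ℕ) ≠ j := fun h => hl.2 (Fin.ext h)
      exact Fin.lt_def.2 (by omega)
  · simp
  · simp

variable {ψ : AddChar F ℂ}

theorem mu_mul (ε : Fin (n - 1) → F) {X Y : Matrix.SpecialLinearGroup (Fin (2 * n)) F}
    (hX : X ∈ upperUnipotent (2 * n) F) (hY : Y ∈ upperUnipotent (2 * n) F) :
    mu ψ ε (X * Y) = mu ψ ε X * mu ψ ε Y := by
  rw [mu, mu, mu, ← AddChar.map_add_eq_mul, ← Finset.sum_add_distrib]
  congr 1
  refine Finset.sum_congr rfl fun j _ => ?_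
  rw [mul_apply_succ hX hY rfl, mul_apply_succ hX hY (by simp only; omega)]
  ring

theorem mu_one (ε : Fin (n - 1) → F) :
    mu ψ ε (1 : Matrix.SpecialLinearGroup (Fin (2 * n)) F) = 1 := by
  have h := mu_mul (ψ := ψ) ε (one_mem (upperUnipotent (2 * n) F)) (one_mem (upperUnipotent (2 * n) F))
  rw [mul_one] at h
  have h0 : mu ψ ε (1 : Matrix.SpecialLinearGroup (Fin (2 * n)) F) ≠ 0 := by
    rw [mu]; exact (AddChar.val_isUnit ψ _).ne_zero
  exact (mul_eq_left₀ h0).1 h.symm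

theorem mu_conj (ε : Fin (n - 1) → F) {X M : Matrix.SpecialLinearGroup (Fin (2 * n)) F}
    (hX : X ∈ upperUnipotent (2 * n) F) (hM : M ∈ upperUnipotent (2 * n) F) :
    mu ψ ε (M * X * M⁻¹) = mu ψ ε X := by
  have hM' := inv_mem hM
  rw [mu_mul ε (mul_mem hM hX) hM', mu_mul ε hM hX, mul_comm (mu ψ ε M), mul_assoc, ← mu_mul ε hM hM',
    mul_inv_cancel, mu_one, mul_one]

/-- Both entries weighted by ε at k lie in the trivial middle block, so choosing that ε later does
not disturb earlier equivariance. -/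
theorem IsOuter.mu_update {X : Matrix.SpecialLinearGroup (Fin (2 * n)) F} (hX : IsOuter k X)
    (hk : k < n - 1) (ε : Fin (n - 1) → F) (c : F) :
    mu ψ (Function.update ε ⟨k, hk⟩ c) X = mu ψ ε X := by
  rw [mu, mu]
  congr 1
  refine Finset.sum_congr rfl fun j _ => ?_
  by_cases hj : j = ⟨k, hk⟩
  · subst hj
    rw [hX _ _ (by simp) (by simp only; omega), hX _ _ (by simp only; omega) (by simp only; omega),
      Matrix.one_apply_ne, Matrix.one_apply_ne, add_zero, mul_zero, mul_zero]
    · simp only [ne_eq, Fin.mk.injEq]; omega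
    · simp only [ne_eq, Fin.mk.injEq]; omega
  · rw [Function.update_of_ne hj]

theorem rowElt_mem (K : Fin (2 * n)) (y : Mid n K → F) : rowElt K y ∈ upperUnipotent (2 * n) F := by
  have h : ∀ i j : Fin (2 * n), j ≤ i → (Pi.single K 1 : Fin (2 * n) → F) i * extMid y j = 0 := by
    intro i j hij
    by_cases hi : i = K
    · subst hi
      rw [extMid_eq_zero, mul_zero]
      have : (j : ℕ) ≤ i := hij
      omega
    · rw [Pi.single_eq_of_ne hi, zero_mul]
  refine ⟨fun i j hij => ?_, fun i => ?_⟩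
  · rw [coe_rowElt, Matrix.add_apply, Matrix.vecMulVec_apply, h i j hij.le,
      Matrix.one_apply_ne hij.ne', add_zero]
  · rw [coe_rowElt, Matrix.add_apply, Matrix.vecMulVec_apply, h i i le_rfl, Matrix.one_apply_eq,
      add_zero]

theorem rowElt_mul_heis_mem {K : Fin (2 * n)} (hK : (K : ℕ) < n) (y w : Mid n K → F) (t : F) :
    rowElt K y * heis K w t ∈ upperUnipotent (2 * n) F := by
  have hrev := Fin.val_rev K
  have h : ∀ i j : Fin (2 * n), j ≤ i →
      (rowElt K y * heis K w t : Matrix.SpecialLinearGroup (Fin (2 * n)) F) i j =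
        (1 : Matrix (Fin (2 * n)) (Fin (2 * n)) F) i j := by
    intro i j hij
    have hij' : (j : ℕ) ≤ i := hij
    rw [coe_rowElt_mul_heis hK, ← extMid_vecMul, ← extMid_add]
    by_cases hj : j = K.rev
    · have hi : i ≠ K := fun h => by rw [hj, h] at hij'; omega
      have hw : extMid w i = 0 := extMid_eq_zero w (by rw [hj] at hij'; omega)
      simp [hi, hw]
    · by_cases hi : i = K
      · have hy : extMid (y + w ᵥ* midGram n K F) j = 0 :=
          extMid_eq_zero _ (by rw [hi] at hij'; omega)
        simp [hj, hy]
      · simp [hi, hj]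
  exact ⟨fun i j hij => by rw [h i j hij.le, Matrix.one_apply_ne hij.ne'],
    fun i => by rw [h i i le_rfl, Matrix.one_apply_eq]⟩

/-- The entry of w enters with a minus sign on one superdiagonal position and a plus sign on the
mirror position, so only y survives. -/
theorem mu_rowElt_mul_heis {K : Fin (2 * n)} (hK : (K : ℕ) < n) (y w : Mid n K → F) (t : F)
    (ε : Fin (n - 1) → F) :
    mu ψ ε (rowElt K y * heis K w t) =
      ψ (∑ j : Fin (n - 1), if (j : ℕ) = K then ε j * extMid y ⟨j + 1, by omega⟩ else 0) := by
  rw [mu]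
  congr 1
  refine Finset.sum_congr rfl fun j _ => ?_
  have hj := j.2
  rw [coe_rowElt_mul_heis hK, coe_rowElt_mul_heis hK, Matrix.one_apply_ne, Matrix.one_apply_ne]
  rotate_left
  · simp only [ne_eq, Fin.mk.injEq]; omega
  · simp only [ne_eq, Fin.mk.injEq]; omega
  have h1 : (⟨j + 1, by omega⟩ : Fin (2 * n)) ≠ K.rev := by
    rw [ne_eq, Fin.ext_iff, Fin.val_rev]; simp only; omega
  have h2 : (⟨2 * n - 2 - j, by omega⟩ : Fin (2 * n)) ≠ K := by
    rw [ne_eq, Fin.ext_iff]; simp only; omega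
  rw [Pi.single_eq_of_ne h1, Pi.single_eq_of_ne h2]
  by_cases hjK : (j : ℕ) = K
  · have h3 : (⟨j, by omega⟩ : Fin (2 * n)) = K := Fin.ext hjK
    have h4 : (⟨2 * n - 1 - j, by omega⟩ : Fin (2 * n)) = K.rev := by
      rw [Fin.ext_iff, Fin.val_rev]; simp only; omega
    have h5 : (extMid w ᵥ* gram n F) ⟨j + 1, by omega⟩ = -extMid w ⟨2 * n - 2 - j, by omega⟩ := by
      rw [vecMul_gram, if_pos (by simp only; omega)]
      congr 2
      rw [Fin.ext_iff, Fin.val_rev]; simp only; omega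
    rw [if_pos hjK, h3, h4, Pi.single_eq_same, Pi.single_eq_same, Pi.add_apply, h5]
    ring
  · have h3 : (⟨j, by omega⟩ : Fin (2 * n)) ≠ K := fun h => hjK (congrArg Fin.val h)
    have h4 : (⟨2 * n - 1 - j, by omega⟩ : Fin (2 * n)) ≠ K.rev := by
      rw [ne_eq, Fin.ext_iff, Fin.val_rev]; simp only; omega
    rw [if_neg hjK, Pi.single_eq_of_ne h3, Pi.single_eq_of_ne h4]
    ring

/-- Factorization of an element whose middle block of size `2 (n - k - 1)` is trivial. -/
theorem exists_eq_mul_rowElt_mul_heis {K : Fin (2 * n)} (hK : (K : ℕ) < n)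
    {X : Matrix.SpecialLinearGroup (Fin (2 * n)) F} (hX : X ∈ upperUnipotent (2 * n) F)
    (hXo : IsOuter (K + 1) X) :
    ∃ u ∈ upperUnipotent (2 * n) F, IsOuter K u ∧ ∃ (y w : Mid n K → F) (t : F),
      X = u * (rowElt K y * heis K w t) := by
  have hrev := Fin.val_rev K
  -- The last column of the block gives w, its first row then gives y, and its corner, which is t +
  -- y · w in the product, gives t.
  let w : Mid n K → F := fun i => X i K.rev
  let y : Mid n K → F := fun j => X K j - (w ᵥ* midGram n K F) j
  let t : F := X K K.rev - y ⬝ᵥ w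
  set M := rowElt K y * heis K w t with hMdef
  have hM : M ∈ upperUnipotent (2 * n) F := rowElt_mul_heis_mem hK y w t
  refine ⟨X * M⁻¹, mul_mem hX (inv_mem hM), isOuter_mul_inv hM fun i j hi hj => ?_, y, w, t, ?_⟩
  · rcases lt_trichotomy j i with hlt | rfl | hlt
    · rw [hX.1 i j hlt, hM.1 i j hlt]
    · rw [hX.2, hM.2]
    · have hlt' : (i : ℕ) < j := hlt
      rw [hMdef, coe_rowElt_mul_heis hK, ← extMid_vecMul, ← extMid_add, Matrix.one_apply_ne hlt.ne]
      by_cases hiK : i = K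
      · have hw : extMid w i = 0 := extMid_eq_zero w (by rw [hiK]; omega)
        by_cases hjK : j = K.rev
        · have hy : extMid (y + w ᵥ* midGram n K F) j = 0 :=
            extMid_eq_zero _ (by rw [hjK]; omega)
          rw [hw, hy, hiK, hjK]
          simp [t]
        · have hjm : (K : ℕ) < j ∧ (j : ℕ) + K + 1 < 2 * n := by
            have : (j : ℕ) ≠ K.rev := fun h => hjK (Fin.ext h)
            rw [hiK] at hlt'
            omega
          have hy : extMid (y + w ᵥ* midGram n K F) j = X K j := by
            rw [extMid, dif_pos hjm]; simp [y]
          rw [hw, hy, hiK, Pi.single_eq_of_ne hjK]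
          simp
      · have hi' : (K : ℕ) + 1 ≤ i := by
          have : (i : ℕ) ≠ K := fun h => hiK (Fin.ext h)
          omega
        rw [Pi.single_eq_of_ne hiK]
        by_cases hjK : j = K.rev
        · have hw : extMid w i = X i K.rev := by
            rw [extMid, dif_pos (by rw [hjK] at hlt'; omega)]
          rw [hw, hjK]
          simp
        · have hj' : (j : ℕ) + (K + 1) + 1 ≤ 2 * n := by
            have : (j : ℕ) ≠ K.rev := fun h => hjK (Fin.ext h)
            omega
          rw [hXo i j hi' hj', Matrix.one_apply_ne hlt.ne, Pi.single_eq_of_ne hjK]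
          simp
  · rw [inv_mul_cancel_right]

end Unipotent

/-! ### Smooth vectors and congruence neighbourhoods. -/

section Smooth

variable {F : Type*} [Field F] [ValuativeRel F] [TopologicalSpace F] [IsNonarchimedeanLocalField F]
  {N : ℕ}

/-- A smooth vector is fixed by all matrices sufficiently close to the identity. -/
theorem IsSmoothRep.exists_fixed {V : Type*} [AddCommGroup V] [Module ℂ V]
    {π : Representation ℂ (Matrix.SpecialLinearGroup (Fin N) F) V} (hπ : IsSmoothRep π) (v : V) :
    ∃ κ : F, κ ≠ 0 ∧ ∀ g : Matrix.SpecialLinearGroup (Fin N) F,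
      (∀ i j, valuation F (g i j - (1 : Matrix (Fin N) (Fin N) F) i j) ≤ valuation F κ) →
        π g v = v := by
  obtain ⟨O, hO, hOS⟩ := isOpen_induced_iff.1 (hπ v)
  have h1 : (1 : Matrix (Fin N) (Fin N) F) ∈ O := by
    have : (1 : Matrix.SpecialLinearGroup (Fin N) F) ∈ {g | π g v = v} := by
      change π 1 v = v
      rw [map_one]; rfl
    rw [← hOS] at this
    exact this
  let f : (Fin N × Fin N → F) → Matrix (Fin N) (Fin N) F := fun x => 1 + Matrix.of fun i j => x (i, j)
  have hf : Continuous f := by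
    refine continuous_const.add (continuous_matrix fun i j => ?_)
    exact continuous_apply (i, j)
  have hf0 : Tendsto f (𝓝 0) (𝓝 1) := hf.tendsto' 0 1 (by ext i j; simp [f])
  obtain ⟨κ, hκ, h⟩ := exists_box_subset (hf0 (hO.mem_nhds h1))
  refine ⟨κ, hκ, fun g hg => ?_⟩
  have hmem := h (show (fun p : Fin N × Fin N => g p.1 p.2 - (1 : Matrix (Fin N) (Fin N) F) p.1 p.2) ∈
    (box (Fin N × Fin N) κ : Set _) from fun p => hg p.1 p.2)
  have hfg : f (fun p : Fin N × Fin N => g p.1 p.2 - (1 : Matrix (Fin N) (Fin N) F) p.1 p.2) =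
      (g : Matrix (Fin N) (Fin N) F) := by
    ext i j; simp [f]
  have : g ∈ {g | π g v = v} := by
    rw [← hOS]
    change (g : Matrix (Fin N) (Fin N) F) ∈ O
    rw [← hfg]
    exact hmem
  exact this

end Smooth

/-! ### The induction on the middle block. -/

section Induction

variable {n : ℕ} {F : Type*} [Field F] {V : Type*} [AddCommGroup V] [Module ℂ V]
  (π : Representation ℂ (Matrix.SpecialLinearGroup (Fin (2 * n)) F) V) (ψ : AddChar F ℂ)

/-- The linear form `l` transforms by `mu ψ ε` under the unipotent matrices with trivial middle
block after removing `k` indices on both sides, and it is invariant under the symplectic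
transvections along vectors of this middle block orthogonal to its first basis vector. -/
structure IsAdapted (k : ℕ) (ε : Fin (n - 1) → F) (l : V →ₗ[ℂ] ℂ) : Prop where
  equivariant : ∀ X ∈ upperUnipotent (2 * n) F, IsOuter k X → ∀ v, l (π X v) = mu ψ ε X * l v
  invariant : ∀ a : Fin (2 * n) → F, ∀ t,
    (∀ i : Fin (2 * n), ¬ (k ≤ (i : ℕ) ∧ (i : ℕ) + k + 1 < 2 * n) → a i = 0) →
    ∀ v, l (π (sTransv a t) v) = l v

variable {π ψ}

theorem IsAdapted.heis {K : Fin (2 * n)} {ε : Fin (n - 1) → F} {l : V →ₗ[ℂ] ℂ}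
    (h : IsAdapted π ψ K ε l) (hK : (K : ℕ) < n) (w : Mid n K → F) (t : F) (v : V) :
    l (π (heis K w t) v) = l v := by
  have h1 : ∀ i : Fin (2 * n), ¬ ((K : ℕ) ≤ (i : ℕ) ∧ (i : ℕ) + K + 1 < 2 * n) →
      (Pi.single K 1 : Fin (2 * n) → F) i = 0 := fun i hi =>
    Pi.single_eq_of_ne (by rintro rfl; omega) _
  have h2 : ∀ i : Fin (2 * n), ¬ ((K : ℕ) ≤ (i : ℕ) ∧ (i : ℕ) + K + 1 < 2 * n) →
      extMid w i = 0 := fun i hi => extMid_eq_zero w (by omega)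
  rw [SymplecticDistinction.heis, map_mul, map_mul, Module.End.mul_apply, Module.End.mul_apply,
    h.invariant _ _ h1, h.invariant _ _ fun i hi => by rw [Pi.add_apply, h1 i hi, h2 i hi, add_zero],
    h.invariant _ _ h2]

theorem isAdapted_zero {l : V →ₗ[ℂ] ℂ} (hl : ∀ h ∈ Sp n F, ∀ v, l (π h v) = l v)
    (ε : Fin (n - 1) → F) : IsAdapted π ψ 0 ε l where
  equivariant X hX hXo v := by
    have : X = 1 := by
      ext i j
      exact hXo i j (Nat.zero_le _) j.2
    rw [this, mu_one, map_one, one_mul]; rfl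
  invariant a t _ v := hl _ (sTransv_mem_Sp a t) v

/-- A form adapted to the last index transforms under the whole group of unipotent matrices. -/
theorem IsAdapted.equivariant_of_last {K : Fin (2 * n)} (hK : (K : ℕ) + 1 = n)
    {ε : Fin (n - 1) → F} {l : V →ₗ[ℂ] ℂ} (h : IsAdapted π ψ K ε l)
    {X : Matrix.SpecialLinearGroup (Fin (2 * n)) F} (hX : X ∈ upperUnipotent (2 * n) F) (v : V) :
    l (π X v) = mu ψ ε X * l v := by
  have hXo : IsOuter ((K : ℕ) + 1) X := fun i j hi hj => by
    rw [hX.1 i j (Fin.lt_def.2 (by omega)), Matrix.one_apply_ne]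
    rintro rfl
    omega
  obtain ⟨u, hu, huo, y, w, t, rfl⟩ := exists_eq_mul_rowElt_mul_heis (by omega) hX hXo
  -- The block left at K = n - 1 has size two, so `Mid n K` is empty; nor does any ε have index n -
  -- 1.
  have hy : y = 0 := by
    ext i
    have := i.2
    omega
  have hmem := rowElt_mul_heis_mem (by omega) y w t
  rw [mu_mul ε hu hmem, mu_rowElt_mul_heis (by omega), map_mul, Module.End.mul_apply,
    h.equivariant u hu huo, hy, rowElt_zero, one_mul, h.heis (by omega), Finset.sum_eq_zero,
    AddChar.map_zero_eq_one, mul_one]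
  intro j _
  rw [if_neg]
  have := j.2
  omega

variable [ValuativeRel F] [TopologicalSpace F] [IsNonarchimedeanLocalField F]

/-- The frequency e is the first basis vector of the next middle block, so the transvections fixing
it include exactly those required at stage k + 1. -/
theorem IsAdapted.exists_succ (hψ : Continuous ψ) (hψ1 : ψ ≠ 1) (hπ : IsSmoothRep π)
    {k : ℕ} (hk : k < n - 1) {ε : Fin (n - 1) → F} {l : V →ₗ[ℂ] ℂ} (hl : l ≠ 0)
    (h : IsAdapted π ψ k ε l) :
    ∃ ε₀ : F, (ε₀ = 0 ∨ ε₀ = 1) ∧ ∃ l' : V →ₗ[ℂ] ℂ, l' ≠ 0 ∧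
      IsAdapted π ψ (k + 1) (Function.update ε ⟨k, hk⟩ ε₀) l' := by
  obtain ⟨K, rfl⟩ : ∃ K : Fin (2 * n), (K : ℕ) = k := ⟨⟨k, by omega⟩, rfl⟩
  have hK : (K : ℕ) < n := by omega
  let p : Mid n K := ⟨⟨K + 1, by omega⟩, by simp only; omega⟩
  have hp : ((p : Fin (2 * n)) : ℕ) = K + 1 := rfl
  let e : Mid n K → F := Pi.single p 1
  have he : e ≠ 0 := fun h0 => one_ne_zero (α := F) (by simpa [e] using congrFun h0 p)
  have hinv : ∀ (a : Mid n K → F) t v, l (π (sTransv (extMid a) t) v) = l v := fun a t =>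
    h.invariant _ t fun i hi => extMid_eq_zero a (by omega)
  obtain ⟨ε₀, hε₀, l', hl', h1, h2, h3⟩ := exists_equivariant_form hψ hψ1
    (isSymplecticGram_midGram (n := n) (k := K) (F := F)) he (fun y => π (rowElt K y))
    (fun a t => π (sTransv (extMid a) t)) hl
    (fun v => by rw [rowElt_zero, map_one]; rfl)
    (fun y y₀ v => by rw [← Module.End.mul_apply, ← map_mul, rowElt_mul])
    (fun a t y v => by
      rw [← Module.End.mul_apply, ← map_mul, rowElt_mul_sTransv, map_mul, Module.End.mul_apply,
        hinv])
    (fun v => by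
      obtain ⟨κ, hκ, hfix⟩ := hπ.exists_fixed v
      refine ⟨κ, hκ, fun u hu => hfix _ fun i j => ?_, fun a t ha => hfix _ fun i j => ?_⟩
      · rw [coe_rowElt, Matrix.add_apply, add_sub_cancel_left, Matrix.vecMulVec_apply]
        by_cases hi : i = K
        · subst hi
          rw [Pi.single_eq_same, one_mul, extMid]
          split_ifs
          · exact hu _
          · simp
        · simp [hi]
      · rw [coe_sTransv, Matrix.add_apply, add_sub_cancel_left, Matrix.smul_apply,
          Matrix.vecMulVec_apply, ← extMid_vecMul]
        by_cases hi : (K : ℕ) < (i : ℕ) ∧ (i : ℕ) + K + 1 < 2 * n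
        · by_cases hj : (K : ℕ) < (j : ℕ) ∧ (j : ℕ) + K + 1 < 2 * n
          · rw [extMid, extMid, dif_pos hi, dif_pos hj, vecMul_midGram, smul_eq_mul, ← mul_assoc]
            split_ifs
            · rw [mul_neg, Valuation.map_neg]; exact ha _ _
            · exact ha _ _
          · simp [extMid_eq_zero _ hj]
        · simp [extMid_eq_zero _ hi])
  refine ⟨ε₀, hε₀, l', hl', ?_, ?_⟩
  · intro X hX hXo v
    obtain ⟨u, hu, huo, y, w, t, rfl⟩ := exists_eq_mul_rowElt_mul_heis hK hX hXo
    have hmem := rowElt_mul_heis_mem hK y w t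
    -- Moving u left past a row element conjugates it, which preserves outerness and `mu`; thus u v
    -- and v have proportional functions.
    have hu' : ∀ v, l' (π u v) = mu ψ ε u * l' v := fun v => h2 _ _ _ fun y' => by
      have hb := rowElt_mem K y'
      rw [← mu_conj ε hu hb, ← h.equivariant _ (mul_mem (mul_mem hb hu) (inv_mem hb)) (huo.conj hb),
        ← Module.End.mul_apply, ← Module.End.mul_apply, ← map_mul, ← map_mul, inv_mul_cancel_right]
    have hheis : ∀ v, l' (π (SymplecticDistinction.heis K w t) v) = l' v := fun v => by
      have := h2 v (π (SymplecticDistinction.heis K w t) v) 1 fun y' => by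
        rw [← Module.End.mul_apply, ← map_mul, rowElt_mul_heis hK, map_mul, Module.End.mul_apply,
          h.heis hK, one_mul]
      rwa [one_mul] at this
    rw [mu_mul _ hu hmem, huo.mu_update, mu_rowElt_mul_heis hK, map_mul, map_mul,
      Module.End.mul_apply, Module.End.mul_apply, hu', h1, hheis, mul_assoc]
    congr 3
    rw [Finset.sum_eq_single ⟨K, hk⟩]
    · rw [if_pos rfl, Function.update_self]
      congr 1
      rw [show e = Pi.single p 1 from rfl, single_dotProduct, one_mul]
      exact (extMid_coe y p).symm
    · intro j _ hj
      exact if_neg fun h => hj (Fin.ext h)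
    · simp
  · intro a t ha v
    let a' : Mid n K → F := fun i => a i
    have haa : extMid a' = a := by
      ext i
      by_cases hi : (K : ℕ) < (i : ℕ) ∧ (i : ℕ) + K + 1 < 2 * n
      · rw [extMid, dif_pos hi]
      · rw [extMid_eq_zero _ hi, ha i (by omega)]
    have := h3 a' t (by
      -- The partner of e is the last index of the next block, which stage k + 1 excludes, so a is
      -- orthogonal to e.
      have hz : a (Mid.rev p : Fin (2 * n)) = 0 := ha _ (by
        rw [Mid.coe_rev, Fin.val_rev, hp]; omega)
      rw [show e = Pi.single p 1 from rfl, dotProduct_single, vecMul_midGram]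
      have hz' : a' (Mid.rev p) = 0 := hz
      simp [hz']) v
    rwa [haa] at this

theorem exists_isAdapted (hψ : Continuous ψ) (hψ1 : ψ ≠ 1) (hπ : IsSmoothRep π)
    (hdist : IsDistinguishedBy π (Sp n F)) (k : ℕ) (hk : k ≤ n - 1) :
    ∃ ε : Fin (n - 1) → F, (∀ i, ε i = 0 ∨ ε i = 1) ∧ ∃ l : V →ₗ[ℂ] ℂ, l ≠ 0 ∧
      IsAdapted π ψ k ε l := by
  induction k with
  | zero =>
    obtain ⟨l, hl, hinv⟩ := hdist
    exact ⟨0, fun _ => Or.inl rfl, l, hl, isAdapted_zero hinv 0⟩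
  | succ k ih =>
    obtain ⟨ε, hε, l, hl, h⟩ := ih (by omega)
    obtain ⟨ε₀, hε₀, l', hl', h'⟩ := h.exists_succ hψ hψ1 hπ hk hl
    refine ⟨_, fun i => ?_, l', hl', h'⟩
    by_cases hi : i = ⟨k, hk⟩
    · rw [hi, Function.update_self]; exact hε₀
    · rw [Function.update_of_ne hi]; exact hε i

end Induction

end SymplecticDistinction

theorem mainTheorem6 (n : ℕ)
    (F : Type*) [Field F] [ValuativeRel F] [TopologicalSpace F] [IsNonarchimedeanLocalField F]
    (ψ : AddChar F ℂ) (hψ : Continuous ψ) (hψ1 : ψ ≠ 1)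
    (V : Type*) [AddCommGroup V] [Module ℂ V]
    (π : Representation ℂ (Matrix.SpecialLinearGroup (Fin (2 * n)) F) V)
    (hπ : SymplecticDistinction.IsSmoothRep π)
    (hdist : SymplecticDistinction.IsDistinguishedBy π (SymplecticDistinction.Sp n F)) :
    ∃ ε : Fin (n - 1) → F, (∀ k, ε k = 0 ∨ ε k = 1) ∧
      ∃ l : V →ₗ[ℂ] ℂ, l ≠ 0 ∧
        ∀ X ∈ SymplecticDistinction.upperUnipotent (2 * n) F, ∀ v : V,
          l (π X v) = SymplecticDistinction.mu ψ ε X * l v := by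
  obtain ⟨ε, hε, l, hl, h⟩ :=
    SymplecticDistinction.exists_isAdapted hψ hψ1 hπ hdist (n - 1) le_rfl
  refine ⟨ε, hε, l, hl, fun X hX v => ?_⟩
  -- For n = 0 there is no last index K, but with no matrix entries every element is outer.
  rcases Nat.eq_zero_or_pos n with rfl | hn
  · exact h.equivariant X hX (fun i => absurd i.2 (by omega)) v
  · obtain ⟨K, hK⟩ : ∃ K : Fin (2 * n), (K : ℕ) = n - 1 := ⟨⟨n - 1, by omega⟩, rfl⟩
    rw [← hK] at h
    exact h.equivariant_of_last (by omega) hX v
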